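/- Let $\mathcal L$ be the many-sorted first-order language with sorts $K$, $M$ and $G^i$ ($i\ge 1$); the symbols $+,\cdot,0,1$ on $K$; $+,0$ on $M$ and $\cdot\colon K\times M\to M$; function symbols $\pi_i\colon K^{i^2}\to G^i$ and $D_i\colon M^i\to G^i$; and, for every quantifier-free formula $\varphi$ in the language $(+,\cdot,0,1)$ of fields together with a partition $\tilde\varphi$ of its variables into blocks of sizes $k_1^2,\dots,k_m^2,l$ (with $m,l\ge 0$, $k_j\ge 1$), a predicate symbol $P_{\tilde\varphi}$ on $G^{k_1}\times\dots\times G^{k_m}\times K^l$. For $d\in\{0,1,2,\dots,\infty\}$ let $\tilde{\mathfrak T}_d$ be the $\mathcal L$-theory stating that: (1) $K$ is an algebraically closed field; (2) $M$ is a vector space over $K$ of dimension $d$ ($d=\infty$ meaning that $M$ is infinite-dimensional); (3) $\pi_i$ is surjective, and $\pi_i(X)=\pi_i(Y)$ if and only if the rows of the $i\times i$ matrices $X$ and $Y$ span the same subspace of $K^i$ (so $G^i$ is the set of all linear subspaces of $K^i$); (4) $P_{\tilde\varphi}(p_1,\dots,p_m,\bar x)$ holds if and only if there are matrices $X_j\in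 K^{k_j^2}$ with $\pi_{k_j}(X_j)=p_j$ for all $j$ and $\varphi(X_1,\dots,X_m,\bar x)$; (5) $D_i(v_1,\dots,v_i)$ is the subspace $\{\bar x\in K^i : \sum_j x_jv_j=0\}$. Then for every $d$ the theory $\tilde{\mathfrak T}_d$ eliminates quantifiers: every formula is equivalent modulo $\tilde{\mathfrak T}_d$ to a quantifier-free formula in the same free variables. Moreover, for every $d$ and every $p$ that is $0$ or a prime number, the theory $\tilde{\mathfrak T}_d$ together with the axioms saying that $K$ has characteristic $p$ is complete, that is, it is consistent and decides every sentence. -/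

import Mathlib

universe u

/-! ## Many-sorted first-order logic -/

namespace ManySorted

/-- A many-sorted first-order signature.  A function symbol `f : Fn s` has values in the sort `s`;
its arguments are indexed by the finite type `FnIdx f`, and the argument with index `i` is of sort
`fnDom f i`.  Likewise for relation symbols. -/
structure Signature where
  Srt : Type
  Fn : Srt → Type
  FnIdx : {s : Srt} → Fn s → Type
  fnFinite : ∀ {s : Srt} (f : Fn s), Finite (FnIdx f)
  fnDom : {s : Srt} → (f : Fn s) → FnIdx f → Srt
  Rel : Type
  RelIdx : Rel → Type
  relFinite : ∀ R : Rel, Finite (RelIdx R)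
  relDom : (R : Rel) → RelIdx R → Srt

/-- Variables of sort `s` in a context, a context being the list of the sorts of the variables
declared in it, the most recently declared one first. -/
inductive Var {S : Type} : List S → S → Type
  | zero {Γ : List S} {s : S} : Var (s :: Γ) s
  | succ {Γ : List S} {s t : S} : Var Γ s → Var (t :: Γ) s

/-- Terms of a given sort with variables in the context `Γ`. -/
inductive Term (L : Signature) (Γ : List L.Srt) : L.Srt → Type
  | var {s : L.Srt} (x : Var Γ s) : Term L Γ s
  | app {s : L.Srt} (f : L.Fn s) (args : (i : L.FnIdx f) → Term L Γ (L.fnDom f i)) : Term L Γ s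

/-- First-order formulas with equality, with free variables in the context `Γ`.  In `all s φ` the
quantified variable, of sort `s`, is the first variable of the context of `φ`. -/
inductive Formula (L : Signature) : List L.Srt → Type
  | falsum {Γ : List L.Srt} : Formula L Γ
  | eq {Γ : List L.Srt} {s : L.Srt} (t₁ t₂ : Term L Γ s) : Formula L Γ
  | rel {Γ : List L.Srt} (R : L.Rel) (args : (i : L.RelIdx R) → Term L Γ (L.relDom R i)) :
      Formula L Γ
  | imp {Γ : List L.Srt} (φ ψ : Formula L Γ) : Formula L Γ
  | all {Γ : List L.Srt} (s : L.Srt) (φ : Formula L (s :: Γ)) : Formula L Γ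

/-- Sentences: formulas without free variables. -/
abbrev Sentence (L : Signature) : Type := Formula L []

namespace Formula

variable {L : Signature} {Γ : List L.Srt}

def not (φ : Formula L Γ) : Formula L Γ := φ.imp falsum

def and (φ ψ : Formula L Γ) : Formula L Γ := (φ.imp ψ.not).not

def iff (φ ψ : Formula L Γ) : Formula L Γ := (φ.imp ψ).and (ψ.imp φ)

def ex (s : L.Srt) (φ : Formula L (s :: Γ)) : Formula L Γ := (all s φ.not).not

/-- The conjunction of a list of formulas. -/
def conj : List (Formula L Γ) → Formula L Γ
  | [] => falsum.not
  | φ :: l => φ.and (conj l)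

/-- The formula contains no quantifier. -/
def IsQF : {Γ : List L.Srt} → Formula L Γ → Prop
  | _, falsum => True
  | _, eq _ _ => True
  | _, rel _ _ => True
  | _, imp φ ψ => φ.IsQF ∧ ψ.IsQF
  | _, all _ _ => False

end Formula

/-- A structure for a many-sorted signature. -/
structure Structure (L : Signature) where
  carrier : L.Srt → Type u
  fn : {s : L.Srt} → (f : L.Fn s) → ((i : L.FnIdx f) → carrier (L.fnDom f i)) → carrier s
  rel : (R : L.Rel) → ((i : L.RelIdx R) → carrier (L.relDom R i)) → Prop

/-- Assignments of elements to the variables of a context. -/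
def Env {L : Signature} (A : Structure.{u} L) (Γ : List L.Srt) : Type u :=
  (s : L.Srt) → Var Γ s → A.carrier s

namespace Env

variable {L : Signature} {A : Structure.{u} L} {Γ : List L.Srt}

/-- The assignment to the empty context. -/
def nil : Env A [] := fun _ x => nomatch x

/-- The assignment extended by `a` as the value of a new first variable. -/
def cons {s : L.Srt} (a : A.carrier s) (ρ : Env A Γ) : Env A (s :: Γ)
  | _, .zero => a
  | _, .succ x => ρ _ x

end Env

/-- The value of a term. -/
def Term.eval {L : Signature} {A : Structure.{u} L} {Γ : List L.Srt} (ρ : Env A Γ) :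
    {s : L.Srt} → Term L Γ s → A.carrier s
  | _, .var x => ρ _ x
  | _, .app f args => A.fn f fun i => (args i).eval ρ

/-- Satisfaction of a formula by an assignment. -/
def Formula.Sat {L : Signature} {A : Structure.{u} L} :
    {Γ : List L.Srt} → Formula L Γ → Env A Γ → Prop
  | _, .falsum, _ => False
  | _, .eq t₁ t₂, ρ => t₁.eval ρ = t₂.eval ρ
  | _, .rel R args, ρ => A.rel R fun i => (args i).eval ρ
  | _, .imp φ ψ, ρ => φ.Sat ρ → ψ.Sat ρ
  | _, .all s φ, ρ => ∀ a : A.carrier s, φ.Sat (ρ.cons a)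

/-- `A` is a model of the set of sentences `T`. -/
def IsModel {L : Signature} (A : Structure.{u} L) (T : Set (Sentence L)) : Prop :=
  ∀ σ ∈ T, σ.Sat (Env.nil : Env A [])

/-- The formula `φ` holds in all models of `T`, for all values of its free variables. -/
def Entails {L : Signature} (T : Set (Sentence L)) {Γ : List L.Srt} (φ : Formula L Γ) : Prop :=
  ∀ A : Structure.{u} L, IsModel A T → ∀ ρ : Env A Γ, φ.Sat ρ

/-- `T` is complete: it has a model, and it decides every sentence. -/
def IsComplete {L : Signature} (T : Set (Sentence L)) : Prop :=
  (∃ A : Structure.{u} L, IsModel A T) ∧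
    ∀ σ : Sentence L, Entails.{u} T σ ∨ Entails.{u} T σ.not

/-- `T` eliminates quantifiers: every formula is equivalent modulo `T` to a quantifier-free formula
in the same free variables. -/
def HasQE {L : Signature} (T : Set (Sentence L)) : Prop :=
  ∀ (Γ : List L.Srt) (φ : Formula L Γ), ∃ ψ : Formula L Γ, ψ.IsQF ∧ Entails.{u} T (φ.iff ψ)

/-! ### Blocks of quantifiers -/

/-- The context `Γ` extended by new variables `x₀, …, xₙ₋₁`, where `xᵢ` is of sort `σ i`. -/
def blk {S : Type} : (n : ℕ) → (Fin n → S) → List S → List S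
  | 0, _, Γ => Γ
  | n + 1, σ, Γ => σ 0 :: blk n (fun i => σ i.succ) Γ

/-- The new variable `xᵢ`. -/
def Var.new {S : Type} {Γ : List S} :
    {n : ℕ} → {σ : Fin n → S} → (i : Fin n) → Var (blk n σ Γ) (σ i)
  | _ + 1, _, ⟨0, _⟩ => .zero
  | _ + 1, σ, ⟨i + 1, h⟩ =>
      .succ (Var.new (σ := fun i => σ i.succ) ⟨i, Nat.lt_of_succ_lt_succ h⟩)

/-- A variable of `Γ` as a variable of the extended context. -/
def Var.old {S : Type} {Γ : List S} {s : S} :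
    (n : ℕ) → (σ : Fin n → S) → Var Γ s → Var (blk n σ Γ) s
  | 0, _, x => x
  | n + 1, σ, x => .succ (Var.old n (fun i => σ i.succ) x)

namespace Formula

variable {L : Signature} {Γ : List L.Srt}

/-- `∀ x₀ … xₙ₋₁, φ`, with `xᵢ` of sort `σ i`. -/
def allBlk : (n : ℕ) → (σ : Fin n → L.Srt) → Formula L (blk n σ Γ) → Formula L Γ
  | 0, _, φ => φ
  | n + 1, σ, φ => allBlk n (fun i => σ i.succ) (all (σ 0) φ)

/-- `∃ x₀ … xₙ₋₁, φ`, with `xᵢ` of sort `σ i`. -/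
def exBlk : (n : ℕ) → (σ : Fin n → L.Srt) → Formula L (blk n σ Γ) → Formula L Γ
  | 0, _, φ => φ
  | n + 1, σ, φ => exBlk n (fun i => σ i.succ) (ex (σ 0) φ)

end Formula

end ManySorted

/-! ## The language of vector spaces with Grassmannian sorts -/

namespace PureVS

open ManySorted

/-- Terms of the language `(+, ·, 0, 1)` of fields with variables in `V`. -/
inductive FieldTerm (V : Type) : Type
  | var (x : V) : FieldTerm V
  | zero : FieldTerm V
  | one : FieldTerm V
  | add (a b : FieldTerm V) : FieldTerm V
  | mul (a b : FieldTerm V) : FieldTerm V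

/-- Quantifier-free formulas of the language of fields with variables in `V`. -/
inductive FieldQF (V : Type) : Type
  | falsum : FieldQF V
  | eq (a b : FieldTerm V) : FieldQF V
  | imp (φ ψ : FieldQF V) : FieldQF V

/-- A quantifier-free formula of the language of fields, together with a partition of its variables
into `m` square blocks, of sizes `(k 0)², …, (k (m - 1))²`, and a block of size `l`. -/
structure PartQF where
  m : ℕ
  k : Fin m → ℕ+
  l : ℕ
  φ : FieldQF ((Σ j : Fin m, Fin (k j) × Fin (k j)) ⊕ Fin l)

/-- The sorts: the field `K`, the vector space `M`, and for every `i > 0` the set `G i` of all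
linear subspaces of `Kⁱ`. -/
inductive VSort : Type
  | K : VSort
  | M : VSort
  | G (i : ℕ+) : VSort

/-- The function symbols, listed by the sort of their values. -/
inductive VFn : VSort → Type
  | zeroK : VFn .K
  | oneK : VFn .K
  | addK : VFn .K
  | mulK : VFn .K
  | zeroM : VFn .M
  | addM : VFn .M
  | smul : VFn .M
  | pi (i : ℕ+) : VFn (.G i)
  | D (i : ℕ+) : VFn (.G i)

/-- The index type of the arguments of a function symbol. -/
abbrev VFn.Idx : {s : VSort} → VFn s → Type
  | _, .zeroK => Fin 0
  | _, .oneK => Fin 0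
  | _, .addK => Fin 2
  | _, .mulK => Fin 2
  | _, .zeroM => Fin 0
  | _, .addM => Fin 2
  | _, .smul => Fin 2
  | _, .pi i => Fin i × Fin i
  | _, .D i => Fin i

theorem VFn.finite_idx : ∀ {s : VSort} (f : VFn s), Finite f.Idx
  | _, .zeroK => inferInstanceAs (Finite (Fin 0))
  | _, .oneK => inferInstanceAs (Finite (Fin 0))
  | _, .addK => inferInstanceAs (Finite (Fin 2))
  | _, .mulK => inferInstanceAs (Finite (Fin 2))
  | _, .zeroM => inferInstanceAs (Finite (Fin 0))
  | _, .addM => inferInstanceAs (Finite (Fin 2))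
  | _, .smul => inferInstanceAs (Finite (Fin 2))
  | _, .pi i => inferInstanceAs (Finite (Fin i × Fin i))
  | _, .D i => inferInstanceAs (Finite (Fin i))

/-- The sorts of the arguments of a function symbol. -/
abbrev VFn.dom : {s : VSort} → (f : VFn s) → f.Idx → VSort
  | _, .zeroK => fun _ => .K
  | _, .oneK => fun _ => .K
  | _, .addK => fun _ => .K
  | _, .mulK => fun _ => .K
  | _, .zeroM => fun _ => .M
  | _, .addM => fun _ => .M
  | _, .smul => ![.K, .M]
  | _, .pi _ => fun _ => .K
  | _, .D _ => fun _ => .M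

/-- The signature with sorts `K`, `M`, `G i`; functions `+, ·, 0, 1` on `K`, `+, 0` on `M`,
`· : K × M → M`, `π i : K^(i²) → G i`, `D i : Mⁱ → G i`; and for every partitioned quantifier-free
field formula a predicate on `G (k 0) × ⋯ × G (k (m - 1)) × K^l`. -/
abbrev sig : Signature where
  Srt := VSort
  Fn := VFn
  FnIdx := VFn.Idx
  fnFinite := VFn.finite_idx
  fnDom := VFn.dom
  Rel := PartQF
  RelIdx R := Fin R.m ⊕ Fin R.l
  relFinite _ := inferInstance
  relDom R := Sum.elim (fun j => .G (R.k j)) (fun _ => .K)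

/-! ### Terms and formulas -/

section Expressions

variable {Γ : List VSort}

/-- Terms of the sort `K`. -/
abbrev KTerm (Γ : List VSort) : Type := Term sig Γ VSort.K

/-- Terms of the sort `M`. -/
abbrev MTerm (Γ : List VSort) : Type := Term sig Γ VSort.M

/-- Terms of the sort `G i`. -/
abbrev GTerm (Γ : List VSort) (i : ℕ+) : Type := Term sig Γ (VSort.G i)

/-- Formulas of the language. -/
abbrev Fm (Γ : List VSort) : Type := Formula sig Γ

def zeroK : KTerm Γ := .app (L := sig) VFn.zeroK fun i : Fin 0 => i.elim0

def oneK : KTerm Γ := .app (L := sig) VFn.oneK fun i : Fin 0 => i.elim0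

def addK (a b : KTerm Γ) : KTerm Γ := .app (L := sig) VFn.addK fun i : Fin 2 => ![a, b] i

def mulK (a b : KTerm Γ) : KTerm Γ := .app (L := sig) VFn.mulK fun i : Fin 2 => ![a, b] i

def zeroM : MTerm Γ := .app (L := sig) VFn.zeroM fun i : Fin 0 => i.elim0

def addM (v w : MTerm Γ) : MTerm Γ := .app (L := sig) VFn.addM fun i : Fin 2 => ![v, w] i

def smul (a : KTerm Γ) (v : MTerm Γ) : MTerm Γ :=
  .app (L := sig) VFn.smul fun i : Fin 2 => match i with
    | 0 => a
    | 1 => v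

/-- `π i` applied to an `i × i` matrix of terms. -/
def piG (i : ℕ+) (X : Fin i → Fin i → KTerm Γ) : GTerm Γ i :=
  .app (L := sig) (VFn.pi i) fun ab : Fin i × Fin i => X ab.1 ab.2

def DG (i : ℕ+) (v : Fin i → MTerm Γ) : GTerm Γ i := .app (L := sig) (VFn.D i) v

/-- The predicate attached to `R`, applied to terms. -/
def predP (R : PartQF) (p : (j : Fin R.m) → GTerm Γ (R.k j)) (x : Fin R.l → KTerm Γ) : Fm Γ :=
  .rel (L := sig) R fun i => match i with
    | .inl j => p j
    | .inr a => x a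

def sumK {n : ℕ} (a : Fin n → KTerm Γ) : KTerm Γ := (List.ofFn a).foldr addK zeroK

def sumM {n : ℕ} (v : Fin n → MTerm Γ) : MTerm Γ := (List.ofFn v).foldr addM zeroM

def powK (a : KTerm Γ) : ℕ → KTerm Γ
  | 0 => oneK
  | n + 1 => mulK (powK a n) a

/-- The term `1 + ⋯ + 1` with `n` summands. -/
def numK : ℕ → KTerm Γ
  | 0 => zeroK
  | n + 1 => addK (numK n) oneK

/-- Substitution of terms of the sort `K` in a term of the language of fields. -/
def FieldTerm.toKTerm {V : Type} (x : V → KTerm Γ) : FieldTerm V → KTerm Γ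
  | .var v => x v
  | .zero => zeroK
  | .one => oneK
  | .add a b => addK (a.toKTerm x) (b.toKTerm x)
  | .mul a b => mulK (a.toKTerm x) (b.toKTerm x)

/-- Substitution of terms of the sort `K` in a quantifier-free formula of the language of fields. -/
def FieldQF.toFm {V : Type} (x : V → KTerm Γ) : FieldQF V → Fm Γ
  | .falsum => .falsum
  | .eq a b => .eq (a.toKTerm x) (b.toKTerm x)
  | .imp φ ψ => .imp (φ.toFm x) (ψ.toFm x)

/-- The last declared variable, the one before it, and the one before that. -/
def v0 {s : VSort} : Term sig (s :: Γ) s := .var .zero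

def v1 {s t : VSort} : Term sig (t :: s :: Γ) s := .var (.succ .zero)

def v2 {s t r : VSort} : Term sig (r :: t :: s :: Γ) s := .var (.succ (.succ .zero))

/-- Quantification over tuples of `n` elements of one sort. -/
abbrev ext (s : VSort) (n : ℕ) (Γ : List VSort) : List VSort := blk n (fun _ => s) Γ

def allT (s : VSort) (n : ℕ) (φ : Fm (ext s n Γ)) : Fm Γ :=
  Formula.allBlk (L := sig) n (fun _ => s) φ

def exT (s : VSort) (n : ℕ) (φ : Fm (ext s n Γ)) : Fm Γ :=
  Formula.exBlk (L := sig) n (fun _ => s) φ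

/-- The `i`-th variable of the last declared tuple. -/
def newT {s : VSort} {n : ℕ} (i : Fin n) : Var (ext s n Γ) s := Var.new (σ := fun _ => s) i

/-- A variable declared before the last declared tuple. -/
def oldT {s t : VSort} {n : ℕ} (x : Var Γ t) : Var (ext s n Γ) t := Var.old n (fun _ => s) x

/-- `n²` variables arranged as an `n × n` matrix. -/
def newMat {n : ℕ} (a b : Fin n) : Var (ext VSort.K (n * n) Γ) VSort.K :=
  newT (finProdFinEquiv (a, b))

/-- The vector `z` lies in the linear span of the rows of the matrix `X`:
`∃ c, ⋀ b, z b = ∑ a, c a * X a b`. -/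
def inRowSpan {n : ℕ} (X : Fin n → Fin n → Var Γ VSort.K) (z : Fin n → Var Γ VSort.K) : Fm Γ :=
  exT .K n <| Formula.conj <| List.ofFn fun b : Fin n =>
    .eq (.var (oldT (z b))) (sumK fun a : Fin n => mulK (.var (newT a)) (.var (oldT (X a b))))

/-- The vectors `v 0, …, v (n - 1)` are linearly independent. -/
def linIndep {n : ℕ} (v : Fin n → Var Γ VSort.M) : Fm Γ :=
  allT .K n <|
    .imp (.eq (sumM fun i : Fin n => smul (.var (newT i)) (.var (oldT (v i)))) zeroM)
      (Formula.conj <| List.ofFn fun i : Fin n => .eq (.var (newT i)) zeroK)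

/-- The vectors `v 0, …, v (n - 1)` span `M`. -/
def spans {n : ℕ} (v : Fin n → Var Γ VSort.M) : Fm Γ :=
  .all (L := sig) VSort.M <| exT .K n <|
    .eq (.var (oldT .zero))
      (sumM fun i : Fin n => smul (.var (newT i)) (.var (oldT (.succ (v i)))))

end Expressions

/-! ### The axioms -/

/-- Sentences of the language. -/
abbrev Sent : Type := Sentence sig

/-- `K` is a field. -/
def fieldAxioms : Set Sent :=
  { .all VSort.K (.all VSort.K (.all VSort.K
      (.eq (addK (addK v0 v1) v2) (addK v0 (addK v1 v2))))),
    .all VSort.K (.all VSort.K (.eq (addK v0 v1) (addK v1 v0))),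
    .all VSort.K (.eq (addK v0 zeroK) v0),
    .all VSort.K (.ex VSort.K (.eq (addK v1 v0) zeroK)),
    .all VSort.K (.all VSort.K (.all VSort.K
      (.eq (mulK (mulK v0 v1) v2) (mulK v0 (mulK v1 v2))))),
    .all VSort.K (.all VSort.K (.eq (mulK v0 v1) (mulK v1 v0))),
    .all VSort.K (.eq (mulK v0 oneK) v0),
    .all VSort.K (.all VSort.K (.all VSort.K
      (.eq (mulK v0 (addK v1 v2)) (addK (mulK v0 v1) (mulK v0 v2))))),
    .not (.eq zeroK oneK),
    .all VSort.K (.imp (.not (.eq v0 zeroK)) (.ex VSort.K (.eq (mulK v1 v0) oneK))) }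

/-- `M` is a vector space over `K`. -/
def vectorSpaceAxioms : Set Sent :=
  { .all VSort.M (.all VSort.M (.all VSort.M
      (.eq (addM (addM v0 v1) v2) (addM v0 (addM v1 v2))))),
    .all VSort.M (.all VSort.M (.eq (addM v0 v1) (addM v1 v0))),
    .all VSort.M (.eq (addM v0 zeroM) v0),
    .all VSort.M (.ex VSort.M (.eq (addM v1 v0) zeroM)),
    .all VSort.M (.all VSort.M (.all VSort.K
      (.eq (smul v0 (addM v1 v2)) (addM (smul v0 v1) (smul v0 v2))))),
    .all VSort.M (.all VSort.K (.all VSort.K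
      (.eq (smul (addK v0 v1) v2) (addM (smul v0 v2) (smul v1 v2))))),
    .all VSort.M (.all VSort.K (.all VSort.K
      (.eq (smul (mulK v0 v1) v2) (smul v0 (smul v1 v2))))),
    .all VSort.M (.eq (smul oneK v0) v0) }

/-- Every element of `G i` is of the form `π i (X)`. -/
def piSurjective (i : ℕ+) : Sent :=
  .all (VSort.G i) <| exT .K (i * i) <|
    .eq (piG i fun a b => .var (newMat a b)) (.var (oldT .zero))

/-- `π i (X) = π i (Y)` if and only if the rows of `X` and the rows of `Y` have the same span:
`∀ X Y, π i (X) = π i (Y) ↔ ∀ z, z ∈ span X ↔ z ∈ span Y`. -/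
def piFibres (i : ℕ+) : Sent :=
  allT .K (i * i) <| allT .K (i * i) <|
    .iff
      (.eq (piG i fun a b => .var (oldT (newMat a b))) (piG i fun a b => .var (newMat a b)))
      (allT .K i <| .iff
        (inRowSpan (fun a b => oldT (oldT (newMat a b))) newT)
        (inRowSpan (fun a b => oldT (newMat a b)) newT))

/-- `D i (v)` is the subspace of all `z` with `∑ a, z a • v a = 0`:
`∀ v X, π i (X) = D i (v) → ∀ z, z ∈ span X ↔ ∑ a, z a • v a = 0`. -/
def dAxiom (i : ℕ+) : Sent :=
  allT .M i <| allT .K (i * i) <|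
    .imp
      (.eq (piG i fun a b => .var (newMat a b)) (DG i fun a => .var (oldT (newT a))))
      (allT .K i <| .iff
        (inRowSpan (fun a b => oldT (newMat a b)) newT)
        (.eq (sumM fun a : Fin i => smul (.var (newT a)) (.var (oldT (oldT (newT a))))) zeroM))

/-- The predicate attached to `R` is the relation induced by the formula of `R`:
`∀ p x, P (p, x) ↔ ∃ X, φ (X, x) ∧ ⋀ j, π (X j) = p j`. -/
noncomputable def pAxiom (R : PartQF) : Sent :=
  let e := Fintype.equivFin (Σ j : Fin R.m, Fin (R.k j) × Fin (R.k j))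
  let σ : Fin R.m → VSort := fun j => .G (R.k j)
  Formula.allBlk (L := sig) R.m σ <| allT .K R.l <|
    .iff
      (predP R (fun j => .var (oldT (Var.new (σ := σ) j))) (fun a => .var (newT a)))
      (exT .K (Fintype.card (Σ j : Fin R.m, Fin (R.k j) × Fin (R.k j))) <|
        .and
          (R.φ.toFm (Sum.elim (fun c => .var (newT (e c))) (fun a => .var (oldT (newT a)))))
          (Formula.conj <| List.ofFn fun j : Fin R.m =>
            .eq (piG (R.k j) fun a b => .var (newT (e ⟨j, (a, b)⟩)))
              (.var (oldT (oldT (Var.new (σ := σ) j))))))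

/-- The theory of vector spaces over a field, with the Grassmannian sorts, the induced predicates
and the maps `D i`. -/
noncomputable def baseTheory : Set Sent :=
  fieldAxioms ∪ vectorSpaceAxioms ∪ Set.range piSurjective ∪ Set.range piFibres ∪
    Set.range pAxiom ∪ Set.range dAxiom

/-- Every monic polynomial of degree `n + 1` has a root in `K`:
`∀ a, ∃ x, x ^ (n + 1) + ∑ i, a i * x ^ i = 0`. -/
def rootAxiom (n : ℕ) : Sent :=
  allT .K (n + 1) <| .ex (L := sig) VSort.K <|
    .eq (addK (powK v0 (n + 1))
      (sumK fun i : Fin (n + 1) => mulK (.var (.succ (newT i))) (powK v0 i))) zeroK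

/-- `M` has dimension `d` over `K`; `d = ⊤` means infinite dimension. -/
def dimAxioms : ℕ∞ → Set Sent
  | (d : ℕ) => {exT .M d (.and (linIndep newT) (spans newT))}
  | ⊤ => Set.range fun n : ℕ => exT .M n (linIndep newT)

/-- `K` has characteristic `p`, where `p` is zero or a prime number. -/
def charAxioms (p : ℕ) : Set Sent :=
  if p = 0 then {σ | ∃ q : ℕ, q.Prime ∧ σ = .not (.eq (numK q) zeroK)}
  else {.eq (numK p) zeroK}

/-- The theory of `d`-dimensional vector spaces over an algebraically closed field, with the
Grassmannian sorts, the induced predicates and the maps `D i`. -/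
noncomputable def theoryACF (d : ℕ∞) : Set Sent :=
  baseTheory ∪ Set.range rootAxiom ∪ dimAxioms d

end PureVS

namespace PureVS

/-! An assignment in a model is described by finitely many field elements: the values of its
`K`-variables, a matrix for each subspace named by a `G`-variable, and one matrix whose rows span
the linear relations among its `M`-variables (`Rep`). The heart of the proof is `formulaDef`: in
such coordinates the truth of any formula is a quantifier-free condition in the language of fields,
uniformly over all algebraically closed fields.

For atomic formulas this is direct (`termDef`): a term of sort `M` is a combination of the
`M`-variables with polynomial coefficients, so equalities and the maps `D` only ask whether certain
vectors lie in the space of relations. A quantifier over any sort becomes a quantifier over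
coordinates of the longer context, restricted by `Compat`; that this restriction is right is
`compat_iff`. Its substance concerns a new vector: a space `U` of relations on the longer tuple is
realized exactly when it restricts to the old relations and has codimension at most `d`. The bound
is necessary because the quotient by the relations embeds in `M`. It is sufficient (`exists_vector`)
because either `U` expresses the new vector through the old ones, or the new vector must be
independent of them, and then the bound forces the old span to be proper. The remaining field
quantifiers are removed by `QFDef.exists`: Chevalley's theorem over ℤ, then the Nullstellensatz to
carry points of residue fields into the given field.

Coordinates are not terms of the language, but each predicate of the signature itself quantifies
over matrices representing its arguments. So a single predicate, applied to the `K`-variables, the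
`G`-variables and one `D` of all the `M`-variables, expresses the condition
(`exists_qf_of_formulaDef`). For a sentence there are no coordinates at all: the condition is a
variable-free field formula, decided by the characteristic. Consistency comes from standard models.
-/

open MvPolynomial in
/-- A common solution of a system of polynomial equations and one inequation in an extension of a
field `k` yields a solution in every algebraically closed extension of `k`. -/
theorem exists_solution_of_isAlgClosed {k L K W ι : Type*} [Field k] [Field L] [Field K]
    [Algebra k L] [Algebra k K] [IsAlgClosed K] [Finite W]
    (f : MvPolynomial W k) (g : ι → MvPolynomial W k) (y : W → L)
    (hg : ∀ i, aeval y (g i) = 0) (hf : aeval y f ≠ 0) :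
    ∃ w : W → K, (∀ i, aeval w (g i) = 0) ∧ aeval w f ≠ 0 := by
  have hprime : (RingHom.ker (aeval (R := k) y)).IsPrime := RingHom.ker_isPrime _
  -- The kernel is prime, hence by the Nullstellensatz equal to the vanishing ideal of its zeros in
  -- `K`; as `f` is outside it, `f` is nonzero at one of these zeros.
  have h : f ∉ vanishingIdeal k (zeroLocus K (RingHom.ker (aeval (R := k) y))) := by
    rwa [IsPrime.vanishingIdeal_zeroLocus, RingHom.mem_ker]
  rw [mem_vanishingIdeal_iff] at h
  push Not at h
  obtain ⟨w, hw, hw'⟩ := h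
  exact ⟨w, fun i => hw _ (hg i), hw'⟩

/-! ### Definable predicates over algebraically closed fields -/

/-- The value of a term of the language of fields. -/
def FieldTerm.eval {V : Type} {K : Type u} [Field K] (x : V → K) : FieldTerm V → K
  | .var v => x v
  | .zero => 0
  | .one => 1
  | .add a b => a.eval x + b.eval x
  | .mul a b => a.eval x * b.eval x

/-- Satisfaction of a quantifier-free formula of the language of fields. -/
def FieldQF.Sat {V : Type} {K : Type u} [Field K] (x : V → K) : FieldQF V → Prop
  | .falsum => False
  | .eq a b => a.eval x = b.eval x
  | .imp φ ψ => φ.Sat x → ψ.Sat x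

/-- Families of functions `K^V → K`, one for every algebraically closed field `K`. -/
abbrev FnFamily (V : Type) : Type (u + 1) :=
  ∀ (K : Type u) [Field K] [IsAlgClosed K], (V → K) → K

/-- Families of predicates on `K^V`, one for every algebraically closed field `K`. -/
abbrev PredFamily (V : Type) : Type (u + 1) :=
  ∀ (K : Type u) [Field K] [IsAlgClosed K], (V → K) → Prop

/-- The family is given by a term of the language of fields. -/
def IsPoly {V : Type} (f : FnFamily.{u} V) : Prop :=
  ∃ t : FieldTerm V, ∀ (K : Type u) [Field K] [IsAlgClosed K] (x : V → K), t.eval x = f K x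

/-- The family is given by a quantifier-free formula of the language of fields. -/
def QFDef {V : Type} (S : PredFamily.{u} V) : Prop :=
  ∃ θ : FieldQF V, ∀ (K : Type u) [Field K] [IsAlgClosed K] (x : V → K), θ.Sat x ↔ S K x

theorem QFDef.congr {V : Type} {S S' : PredFamily.{u} V} (h : QFDef S)
    (e : ∀ (K : Type u) [Field K] [IsAlgClosed K] (x : V → K), S K x ↔ S' K x) : QFDef S' := by
  obtain ⟨θ, hθ⟩ := h
  exact ⟨θ, fun K _ _ x => (hθ K x).trans (e K x)⟩

/-! ### Constructible sets in the spectrum of ℤ[V] and elimination over algebraically closed fields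
-/

section Constructible

open MvPolynomial PrimeSpectrum Topology

/-- The evaluation at `x` of polynomials with integral coefficients. -/
noncomputable def evalHom {V : Type} {K : Type u} [Field K] (x : V → K) :
    MvPolynomial V ℤ →+* K :=
  eval₂Hom (Int.castRingHom K) x

/-- The point of the spectrum of `ℤ[V]` corresponding to a point of `K^V`. -/
noncomputable def specPoint {V : Type} {K : Type u} [Field K] (x : V → K) :
    PrimeSpectrum (MvPolynomial V ℤ) :=
  ⟨RingHom.ker (evalHom x), RingHom.ker_isPrime _⟩

theorem mem_specPoint {V : Type} {K : Type u} [Field K] (x : V → K) (f : MvPolynomial V ℤ) :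
    f ∈ (specPoint x).asIdeal ↔ evalHom x f = 0 := Iff.rfl

theorem exists_polynomial_of_term {V : Type} (t : FieldTerm V) :
    ∃ f : MvPolynomial V ℤ, ∀ (K : Type u) [Field K] (x : V → K), evalHom x f = t.eval x := by
  induction t with
  | var v => exact ⟨X v, fun K _ x => by simp [evalHom, FieldTerm.eval]⟩
  | zero => exact ⟨0, fun K _ x => by simp [FieldTerm.eval]⟩
  | one => exact ⟨1, fun K _ x => by simp [FieldTerm.eval]⟩
  | add a b ha hb =>
    obtain ⟨f, hf⟩ := ha
    obtain ⟨g, hg⟩ := hb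
    exact ⟨f + g, fun K _ x => by simp [FieldTerm.eval, hf, hg]⟩
  | mul a b ha hb =>
    obtain ⟨f, hf⟩ := ha
    obtain ⟨g, hg⟩ := hb
    exact ⟨f * g, fun K _ x => by simp [FieldTerm.eval, hf, hg]⟩

theorem exists_term_natCast (V : Type) (n : ℕ) :
    ∃ t : FieldTerm V, ∀ (K : Type u) [Field K] (x : V → K), t.eval x = n := by
  induction n with
  | zero => exact ⟨.zero, fun K _ x => by simp [FieldTerm.eval]⟩
  | succ n ih =>
    obtain ⟨t, ht⟩ := ih
    exact ⟨t.add .one, fun K _ x => by simp [FieldTerm.eval, ht]⟩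

/-- The language of fields has no subtraction, so a polynomial with negative coefficients is kept as
a difference of two terms. -/
theorem exists_terms_of_polynomial {V : Type} (f : MvPolynomial V ℤ) :
    ∃ a b : FieldTerm V, ∀ (K : Type u) [Field K] (x : V → K),
      evalHom x f = a.eval x - b.eval x := by
  induction f using MvPolynomial.induction_on with
  | C n =>
    obtain ⟨a, ha⟩ := exists_term_natCast.{u} V n.toNat
    obtain ⟨b, hb⟩ := exists_term_natCast.{u} V (-n).toNat
    refine ⟨a, b, fun K _ x => ?_⟩
    rw [ha, hb]
    have h : (n : ℤ) = (n.toNat : ℤ) - ((-n).toNat : ℤ) := by omega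
    have h' : (n : K) = (n.toNat : K) - ((-n).toNat : K) := by exact_mod_cast congrArg (Int.cast (R := K)) h
    simpa [evalHom] using h'
  | add p q hp hq =>
    obtain ⟨a, b, h⟩ := hp
    obtain ⟨c, d, h'⟩ := hq
    refine ⟨a.add c, b.add d, fun K _ x => ?_⟩
    simp only [map_add, h, h', FieldTerm.eval]
    ring
  | mul_X p v hp =>
    obtain ⟨a, b, h⟩ := hp
    refine ⟨a.mul (.var v), b.mul (.var v), fun K _ x => ?_⟩
    have hX : evalHom x (X v) = x v := by simp [evalHom]
    simp only [map_mul, h, hX, FieldTerm.eval]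
    ring

theorem QFDef.falsum {V : Type} : QFDef.{u} (V := V) fun _ _ _ _ => False :=
  ⟨.falsum, fun _ _ _ _ => Iff.rfl⟩

theorem QFDef.imp {V : Type} {S S' : PredFamily.{u} V} (h : QFDef S) (h' : QFDef S') :
    QFDef fun K _ _ x => S K x → S' K x := by
  obtain ⟨θ, hθ⟩ := h
  obtain ⟨θ', hθ'⟩ := h'
  exact ⟨θ.imp θ', fun K _ _ x => by simp only [FieldQF.Sat, hθ, hθ']⟩

theorem QFDef.not {V : Type} {S : PredFamily.{u} V} (h : QFDef S) :
    QFDef fun K _ _ x => ¬ S K x :=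
  h.imp .falsum

theorem QFDef.true {V : Type} : QFDef.{u} (V := V) fun _ _ _ _ => True :=
  QFDef.falsum.not.congr fun _ _ _ _ => by simp

theorem QFDef.and {V : Type} {S S' : PredFamily.{u} V} (h : QFDef S) (h' : QFDef S') :
    QFDef fun K _ _ x => S K x ∧ S' K x :=
  (h.imp h'.not).not.congr fun _ _ _ _ => by tauto

theorem QFDef.iff {V : Type} {S S' : PredFamily.{u} V} (h : QFDef S) (h' : QFDef S') :
    QFDef fun K _ _ x => S K x ↔ S' K x :=
  ((h.imp h').and (h'.imp h)).congr fun _ _ _ _ => by tauto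

theorem QFDef.forall_fintype {V ι : Type} [Finite ι] {S : ι → PredFamily.{u} V}
    (h : ∀ i, QFDef (S i)) : QFDef fun K _ _ x => ∀ i, S i K x := by
  classical
  cases nonempty_fintype ι
  have key : ∀ s : Finset ι, QFDef fun K _ _ x => ∀ i ∈ s, S i K x := by
    intro s
    induction s using Finset.induction_on with
    | empty => exact QFDef.true.congr fun _ _ _ _ => by simp
    | insert a s _ ih =>
      exact ((h a).and ih).congr fun _ _ _ _ => by rw [Finset.forall_mem_insert]
  exact (key Finset.univ).congr fun _ _ _ _ => by simp

theorem QFDef.polynomial_eq_zero {V : Type} (f : MvPolynomial V ℤ) :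
    QFDef.{u} fun _ _ _ x => evalHom x f = 0 := by
  obtain ⟨a, b, h⟩ := exists_terms_of_polynomial.{u} f
  exact ⟨.eq a b, fun K _ _ x => by simp only [FieldQF.Sat, h, sub_eq_zero]⟩

theorem BasicConstructibleSetData.specPoint_mem {V : Type} {K : Type u} [Field K] (x : V → K)
    (c : BasicConstructibleSetData (MvPolynomial V ℤ)) :
    specPoint x ∈ c.toSet ↔ (∀ i, evalHom x (c.g i) = 0) ∧ ¬ evalHom x c.f = 0 := by
  simp only [BasicConstructibleSetData.toSet, Set.mem_sdiff, mem_zeroLocus, Set.singleton_subset_iff,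
    SetLike.mem_coe, mem_specPoint, Set.range_subset_iff]

/-- A constructible set is a finite union of sets cut out by finitely many equations and one
inequation, and membership of `specPoint x` evaluates these at `x`. -/
theorem qfDef_of_isConstructible {V : Type} {C : Set (PrimeSpectrum (MvPolynomial V ℤ))}
    (hC : IsConstructible C) : QFDef.{u} fun _ _ _ x => specPoint x ∈ C := by
  obtain ⟨D, rfl⟩ := exists_constructibleSetData_iff.mpr hC
  have h : QFDef.{u} fun K _ _ (x : V → K) => ∀ c : D, ¬ ((∀ i, evalHom x (c.1.g i) = 0) ∧
      ¬ evalHom x c.1.f = 0) :=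
    .forall_fintype fun c => .not <| .and (.forall_fintype fun i => .polynomial_eq_zero _)
      (.not (.polynomial_eq_zero _))
  refine h.not.congr fun K _ _ x => ?_
  simp only [← BasicConstructibleSetData.specPoint_mem, ConstructibleSetData.toSet, Set.mem_iUnion]
  simp

theorem exists_isConstructible_of_formula {V : Type} (θ : FieldQF V) :
    ∃ C : Set (PrimeSpectrum (MvPolynomial V ℤ)), IsConstructible C ∧
      ∀ (K : Type u) [Field K] (x : V → K), θ.Sat x ↔ specPoint x ∈ C := by
  induction θ with
  | falsum => exact ⟨∅, .empty, fun _ _ _ => by simp [FieldQF.Sat]⟩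
  | eq a b =>
    obtain ⟨f, hf⟩ := exists_polynomial_of_term.{u} a
    obtain ⟨g, hg⟩ := exists_polynomial_of_term.{u} b
    -- The inequation is `1 ≠ 0`, which is vacuous; the only equation is `f - g = 0`.
    refine ⟨_, ConstructibleSetData.isConstructible_toSet {⟨1, 1, ![f - g]⟩}, fun K _ x => ?_⟩
    simp only [ConstructibleSetData.toSet, Finset.mem_singleton, Set.iUnion_iUnion_eq_left,
      BasicConstructibleSetData.specPoint_mem]
    simp [FieldQF.Sat, hf, hg, sub_eq_zero]
  | imp φ ψ hφ hψ =>
    obtain ⟨C, hC, h⟩ := hφ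
    obtain ⟨D, hD, h'⟩ := hψ
    refine ⟨Cᶜ ∪ D, hC.compl.union hD, fun K _ x => ?_⟩
    rw [FieldQF.Sat, h, h', Set.mem_union, Set.mem_compl_iff, imp_iff_not_or]

/-- The ring homomorphism `ℤ[V ⊔ W] → ℤ[V][W]`. -/
noncomputable def curryHom (V W : Type) :
    MvPolynomial (V ⊕ W) ℤ →+* MvPolynomial W (MvPolynomial V ℤ) :=
  eval₂Hom (Int.castRingHom _) (Sum.elim (fun v => C (X v)) X)

theorem ringHom_curryHom {V W : Type} {R : Type*} [CommRing R]
    (h : MvPolynomial W (MvPolynomial V ℤ) →+* R) (f : MvPolynomial (V ⊕ W) ℤ) :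
    h (curryHom V W f) =
      eval₂Hom (Int.castRingHom R) (Sum.elim (fun v => h (C (X v))) fun w => h (X w)) f := by
  have : h.comp (curryHom V W) =
      eval₂Hom (Int.castRingHom R) (Sum.elim (fun v => h (C (X v))) fun w => h (X w)) := by
    apply MvPolynomial.ringHom_ext
    · intro n; simp
    · rintro (v | w) <;> simp [curryHom]
  exact congrArg (fun g => g f) this

/-- Quantifier elimination for algebraically closed fields, for a block of existential
quantifiers. -/
theorem QFDef.exists {V W : Type} [Finite W]
    {S : ∀ (K : Type u) [Field K] [IsAlgClosed K], (V → K) → (W → K) → Prop}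
    (h : QFDef.{u} (V := V ⊕ W) fun K _ _ x => S K (fun v => x (Sum.inl v)) fun w => x (Sum.inr w)) :
    QFDef.{u} fun K _ _ x => ∃ w, S K x w := by
  obtain ⟨θ, hθ⟩ := h
  obtain ⟨D, hD, hθD⟩ := exists_isConstructible_of_formula.{u} θ
  obtain ⟨D, rfl⟩ := exists_constructibleSetData_iff.mpr hD
  have hfp : (C : MvPolynomial V ℤ →+* MvPolynomial W (MvPolynomial V ℤ)).FinitePresentation :=
    RingHom.finitePresentation_algebraMap.mpr inferInstance
  -- Chevalley's theorem. Finiteness of `W` makes ℤ[V][W] finitely presented over ℤ[V].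
  have hC := isConstructible_comap_image hfp
    (ConstructibleSetData.isConstructible_toSet (D.map (curryHom V W)))
  refine (qfDef_of_isConstructible hC).congr fun K _ _ x => ?_
  have hS : ∀ w : W → K, S K x w ↔ specPoint (Sum.elim x w) ∈ D.toSet := by
    intro w
    rw [← hθD, hθ]
    simp
  simp only [hS]
  have hx : ∀ w : W → K, evalHom (Sum.elim x w) =
      (eval₂Hom (evalHom x) w).comp (curryHom V W) := by
    intro w
    apply MvPolynomial.ringHom_ext
    · intro n; simp
    · rintro (v | w) <;> rw [RingHom.comp_apply, ringHom_curryHom] <;>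
      simp [evalHom]
  constructor
  · rintro ⟨q, hq, hqx⟩
    rw [ConstructibleSetData.toSet_map, Set.mem_preimage, ConstructibleSetData.toSet,
      Set.mem_iUnion₂] at hq
    obtain ⟨c, hcD, hc⟩ := hq
    -- The prime `q` lies over the kernel of `evalHom x`, so the residue field of that kernel maps
    -- both to `K` and to the residue field at `q`. In the latter the classes of the variables solve
    -- the system.
    let k := (specPoint x).asIdeal.ResidueField
    let φ : k →+* K := Ideal.ResidueField.lift _ (evalHom x) le_rfl fun f hf =>
      isUnit_iff_ne_zero.mpr hf
    let ψ : k →+* q.asIdeal.ResidueField := Ideal.ResidueField.map _ _ C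
      (congrArg PrimeSpectrum.asIdeal hqx.symm)
    let : Algebra k K := φ.toAlgebra
    let : Algebra k q.asIdeal.ResidueField := ψ.toAlgebra
    let y : W → q.asIdeal.ResidueField := fun w => algebraMap _ _ (X (R := MvPolynomial V ℤ) w)
    let F : MvPolynomial (V ⊕ W) ℤ → MvPolynomial W k := fun f =>
      MvPolynomial.map (algebraMap (MvPolynomial V ℤ) k) (curryHom V W f)
    have hy : ∀ f, aeval y (F f) = algebraMap _ q.asIdeal.ResidueField (curryHom V W f) := by
      intro f
      have : (aeval (R := k) y).toRingHom.comp (MvPolynomial.map (algebraMap (MvPolynomial V ℤ) k))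
          = algebraMap _ q.asIdeal.ResidueField := by
        apply MvPolynomial.ringHom_ext
        · intro r
          simp only [AlgHom.toRingHom_eq_coe, RingHom.coe_comp, RingHom.coe_coe,
            Function.comp_apply, map_C, algHom_C]
          exact Ideal.ResidueField.map_algebraMap _ _ _ _ r
        · intro w
          simp [y]
      exact congrArg (fun g => g (curryHom V W f)) this
    have hw : ∀ (w : W → K) f, aeval w (F f) = evalHom (Sum.elim x w) f := by
      intro w f
      have : (aeval (R := k) w).toRingHom.comp (MvPolynomial.map (algebraMap (MvPolynomial V ℤ) k))
          = eval₂Hom (evalHom x) w := by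
        apply MvPolynomial.ringHom_ext
        · intro r
          simp only [AlgHom.toRingHom_eq_coe, RingHom.coe_comp, RingHom.coe_coe,
            Function.comp_apply, map_C, algHom_C]
          exact (Ideal.ResidueField.lift_algebraMap _ _ _ _ r).trans (by simp)
        · intro w
          simp
      rw [hx]
      exact congrArg (fun g => g (curryHom V W f)) this
    have hcg : ∀ f, curryHom V W f ∈ q.asIdeal ↔ aeval y (F f) = 0 := by
      intro f
      rw [hy, Ideal.algebraMap_residueField_eq_zero]
    simp only [BasicConstructibleSetData.toSet, Set.mem_sdiff, mem_zeroLocus,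
      Set.singleton_subset_iff, SetLike.mem_coe, Set.range_subset_iff, comap_asIdeal,
      Ideal.mem_comap, hcg] at hc
    -- The Nullstellensatz transfers solvability from the residue field at `q` to `K`.
    obtain ⟨w, hw1, hw2⟩ := exists_solution_of_isAlgClosed (K := K) (F c.f) (fun i => F (c.g i)) y
      hc.1 hc.2
    refine ⟨w, ?_⟩
    rw [ConstructibleSetData.toSet, Set.mem_iUnion₂]
    refine ⟨c, hcD, ?_⟩
    rw [BasicConstructibleSetData.specPoint_mem]
    simp only [hw] at hw1 hw2
    exact ⟨hw1, hw2⟩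
  · rintro ⟨w, hw⟩
    -- The kernel of evaluation at `(x, w)` is the required point of the fibre over `specPoint x`.
    refine ⟨⟨RingHom.ker (eval₂Hom (evalHom x) w), RingHom.ker_isPrime _⟩, ?_, ?_⟩
    · rw [ConstructibleSetData.toSet_map, Set.mem_preimage]
      convert hw
      ext f
      simp only [comap_asIdeal, Ideal.mem_comap, mem_specPoint, hx, RingHom.mem_ker]
      rfl
    · ext f
      simp only [comap_asIdeal, Ideal.mem_comap, mem_specPoint, RingHom.mem_ker]
      simp
end Constructible

/-! ### Closure properties of definable families -/

theorem FieldTerm.exists_subst {V V' : Type} {f : V → FnFamily.{u} V'} (hf : ∀ v, IsPoly (f v))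
    (t : FieldTerm V) : IsPoly fun K _ _ x => t.eval fun v => f v K x := by
  induction t with
  | var v => exact hf v
  | zero => exact ⟨.zero, fun _ _ _ _ => rfl⟩
  | one => exact ⟨.one, fun _ _ _ _ => rfl⟩
  | add a b ha hb =>
    obtain ⟨s, hs⟩ := ha
    obtain ⟨t, ht⟩ := hb
    exact ⟨.add s t, fun K _ _ x => by simp only [FieldTerm.eval, hs, ht]⟩
  | mul a b ha hb =>
    obtain ⟨s, hs⟩ := ha
    obtain ⟨t, ht⟩ := hb
    exact ⟨.mul s t, fun K _ _ x => by simp only [FieldTerm.eval, hs, ht]⟩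

theorem IsPoly.var {V : Type} (v : V) : IsPoly.{u} fun _ _ _ x => x v :=
  ⟨.var v, fun _ _ _ _ => rfl⟩

theorem IsPoly.zero {V : Type} : IsPoly.{u} (V := V) fun _ _ _ _ => 0 :=
  ⟨.zero, fun _ _ _ _ => rfl⟩

theorem IsPoly.one {V : Type} : IsPoly.{u} (V := V) fun _ _ _ _ => 1 :=
  ⟨.one, fun _ _ _ _ => rfl⟩

theorem IsPoly.add {V : Type} {f g : FnFamily.{u} V} (hf : IsPoly f) (hg : IsPoly g) :
    IsPoly fun K _ _ x => f K x + g K x := by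
  obtain ⟨s, hs⟩ := hf
  obtain ⟨t, ht⟩ := hg
  exact ⟨.add s t, fun K _ _ x => by simp only [FieldTerm.eval, hs, ht]⟩

theorem IsPoly.mul {V : Type} {f g : FnFamily.{u} V} (hf : IsPoly f) (hg : IsPoly g) :
    IsPoly fun K _ _ x => f K x * g K x := by
  obtain ⟨s, hs⟩ := hf
  obtain ⟨t, ht⟩ := hg
  exact ⟨.mul s t, fun K _ _ x => by simp only [FieldTerm.eval, hs, ht]⟩

theorem IsPoly.sum {V ι : Type} [Fintype ι] {f : ι → FnFamily.{u} V} (hf : ∀ i, IsPoly (f i)) :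
    IsPoly fun K _ _ x => ∑ i, f i K x := by
  classical
  have key : ∀ s : Finset ι, IsPoly fun K _ _ x => ∑ i ∈ s, f i K x := by
    intro s
    induction s using Finset.induction_on with
    | empty => simpa using IsPoly.zero
    | insert a s ha ih => simpa only [Finset.sum_insert ha] using (hf a).add ih
  exact key Finset.univ

theorem IsPoly.comp {V V' : Type} {f : FnFamily.{u} V} (hf : IsPoly f) {g : V → FnFamily.{u} V'}
    (hg : ∀ v, IsPoly (g v)) : IsPoly fun K _ _ x => f K fun v => g v K x := by
  obtain ⟨t, ht⟩ := hf
  obtain ⟨s, hs⟩ := t.exists_subst hg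
  exact ⟨s, fun K _ _ x => by simp only [hs, ht]⟩

theorem QFDef.eq {V : Type} {f g : FnFamily.{u} V} (hf : IsPoly f) (hg : IsPoly g) :
    QFDef fun K _ _ x => f K x = g K x := by
  obtain ⟨s, hs⟩ := hf
  obtain ⟨t, ht⟩ := hg
  exact ⟨.eq s t, fun K _ _ x => by simp only [FieldQF.Sat, hs, ht]⟩

theorem QFDef.subst {V V' : Type} (θ : FieldQF V) {g : V → FnFamily.{u} V'}
    (hg : ∀ v, IsPoly (g v)) : QFDef fun K _ _ x => θ.Sat fun v => g v K x := by
  induction θ with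
  | falsum => exact .falsum
  | eq a b => exact .eq (a.exists_subst hg) (b.exists_subst hg)
  | imp φ ψ hφ hψ => exact hφ.imp hψ

theorem QFDef.comp {V V' : Type} {S : PredFamily.{u} V} (hS : QFDef S) {g : V → FnFamily.{u} V'}
    (hg : ∀ v, IsPoly (g v)) : QFDef fun K _ _ x => S K fun v => g v K x := by
  obtain ⟨θ, hθ⟩ := hS
  exact (QFDef.subst θ hg).congr fun K _ _ x => hθ K _

theorem QFDef.forall {V W : Type} [Finite W]
    {S : ∀ (K : Type u) [Field K] [IsAlgClosed K], (V → K) → (W → K) → Prop}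
    (h : QFDef.{u} (V := V ⊕ W) fun K _ _ x => S K (fun v => x (Sum.inl v)) fun w => x (Sum.inr w)) :
    QFDef.{u} fun K _ _ x => ∀ w, S K x w :=
  (QFDef.exists (S := fun K _ _ x w => ¬ S K x w) h.not).not.congr fun _ _ _ _ => by simp

/-! ### Subspaces as row spans -/

/-- The span of the rows of a matrix. -/
def rowSpan {R C : Type} {K : Type u} [Field K] (X : R → C → K) : Submodule K (C → K) :=
  Submodule.span K (Set.range X)

theorem mem_rowSpan {R C : Type} [Fintype R] {K : Type u} [Field K] {X : R → C → K} {z : C → K} :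
    z ∈ rowSpan X ↔ ∃ c : R → K, ∀ b, z b = ∑ a, c a * X a b := by
  rw [rowSpan, Submodule.mem_span_range_iff_exists_fun]
  refine exists_congr fun c => ⟨fun h b => ?_, fun h => ?_⟩
  · rw [← h, Finset.sum_apply]; rfl
  · ext b
    rw [h, Finset.sum_apply]; rfl

theorem exists_span_range_eq_top {ι K N : Type*} [Fintype ι] [Field K] [AddCommGroup N]
    [Module K N] [Module.Finite K N] (h : Module.finrank K N ≤ Fintype.card ι) :
    ∃ b : ι → N, Submodule.span K (Set.range b) = ⊤ := by
  let b := Module.finBasis K N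
  let e := Fintype.equivFin ι
  -- A basis, padded with zeros to fill the index set.
  refine ⟨fun a => if h : (e a : ℕ) < Module.finrank K N then b ⟨e a, h⟩ else 0, ?_⟩
  rw [eq_top_iff, ← b.span_eq]
  refine Submodule.span_mono ?_
  rintro _ ⟨i, rfl⟩
  exact ⟨e.symm ⟨i, i.2.trans_le h⟩, by simp⟩

/-- Every subspace of `K^C` is the row span of a `C × C` matrix. -/
theorem exists_rowSpan_eq {C : Type} [Finite C] {K : Type u} [Field K]
    (U : Submodule K (C → K)) : ∃ X : C → C → K, rowSpan X = U := by
  cases nonempty_fintype C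
  have h : Module.finrank K U ≤ Fintype.card C := by
    simpa using Submodule.finrank_le U
  obtain ⟨b, hb⟩ := exists_span_range_eq_top h
  refine ⟨fun a => b a, ?_⟩
  have : Set.range (fun a => (b a : C → K)) = U.subtype '' Set.range b := by
    rw [← Set.range_comp]; rfl
  rw [rowSpan, this, Submodule.span_image, hb, Submodule.map_top, Submodule.range_subtype]

/-- Membership is solvability of a linear system in the coefficients, and these existentially
quantified coefficients are eliminated. -/
theorem QFDef.mem_rowSpan {V R C : Type} [Finite R] [Finite C] {X : R → C → FnFamily.{u} V}
    (hX : ∀ a b, IsPoly (X a b)) {z : C → FnFamily.{u} V} (hz : ∀ b, IsPoly (z b)) :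
    QFDef fun K _ _ x => (fun b => z b K x) ∈ rowSpan fun a b => X a b K x := by
  cases nonempty_fintype R
  simp only [PureVS.mem_rowSpan]
  refine QFDef.exists (.forall_fintype fun b => .eq ((hz b).comp fun v => .var _)
    (.sum fun a => .mul (.var _) ((hX a b).comp fun v => .var _)))

end PureVS

/-! ### Semantics of blocks of variables and quantifiers -/

namespace ManySorted

variable {L : Signature} {A : Structure.{u} L} {Γ : List L.Srt}

/-- An assignment extended by values of a block of new variables. -/
def Env.blk : {n : ℕ} → {σ : Fin n → L.Srt} → (a : (i : Fin n) → A.carrier (σ i)) →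
    Env A Γ → Env A (ManySorted.blk n σ Γ)
  | 0, _, _, ρ => ρ
  | _ + 1, _, a, ρ => Env.cons (a 0) (Env.blk (fun i => a i.succ) ρ)

theorem Env.blk_new : ∀ {n : ℕ} {σ : Fin n → L.Srt} (a : (i : Fin n) → A.carrier (σ i))
    (ρ : Env A Γ) (i : Fin n), Env.blk a ρ _ (Var.new i) = a i
  | _ + 1, _, _, _, ⟨0, _⟩ => rfl
  | _ + 1, _, a, ρ, ⟨i + 1, h⟩ =>
    Env.blk_new (fun i => a i.succ) ρ ⟨i, Nat.lt_of_succ_lt_succ h⟩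

theorem Env.blk_old {s : L.Srt} (x : Var Γ s) : ∀ {n : ℕ} {σ : Fin n → L.Srt}
    (a : (i : Fin n) → A.carrier (σ i)) (ρ : Env A Γ), Env.blk a ρ _ (Var.old n σ x) = ρ _ x
  | 0, _, _, _ => rfl
  | _ + 1, _, a, ρ => Env.blk_old x (fun i => a i.succ) ρ

namespace Formula

theorem sat_not {φ : Formula L Γ} {ρ : Env A Γ} : φ.not.Sat ρ ↔ ¬ φ.Sat ρ := Iff.rfl

theorem sat_imp {φ ψ : Formula L Γ} {ρ : Env A Γ} : (φ.imp ψ).Sat ρ ↔ (φ.Sat ρ → ψ.Sat ρ) :=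
  Iff.rfl

theorem sat_all {s : L.Srt} {φ : Formula L (s :: Γ)} {ρ : Env A Γ} :
    (all s φ).Sat ρ ↔ ∀ a, φ.Sat (ρ.cons a) := Iff.rfl

theorem sat_eq {s : L.Srt} {t t' : Term L Γ s} {ρ : Env A Γ} :
    (eq t t').Sat ρ ↔ t.eval ρ = t'.eval ρ := Iff.rfl

theorem sat_and {φ ψ : Formula L Γ} {ρ : Env A Γ} :
    (φ.and ψ).Sat ρ ↔ φ.Sat ρ ∧ ψ.Sat ρ := by
  simp only [and, not, Sat]; tauto

theorem sat_iff {φ ψ : Formula L Γ} {ρ : Env A Γ} :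
    (φ.iff ψ).Sat ρ ↔ (φ.Sat ρ ↔ ψ.Sat ρ) := by
  rw [iff, sat_and, sat_imp, sat_imp]; tauto

theorem sat_ex {s : L.Srt} {φ : Formula L (s :: Γ)} {ρ : Env A Γ} :
    (ex s φ).Sat ρ ↔ ∃ a, φ.Sat (ρ.cons a) := by
  simp only [ex, sat_not, sat_all, not_forall, not_not]

theorem sat_conj {l : List (Formula L Γ)} {ρ : Env A Γ} :
    (conj l).Sat ρ ↔ ∀ φ ∈ l, φ.Sat ρ := by
  induction l with
  | nil => simp [conj, not, Sat]
  | cons φ l ih => simp [conj, sat_and, ih]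

theorem sat_conj_ofFn {n : ℕ} {φ : Fin n → Formula L Γ} {ρ : Env A Γ} :
    (conj (List.ofFn φ)).Sat ρ ↔ ∀ i, (φ i).Sat ρ := by
  simp [sat_conj, List.mem_ofFn]

theorem sat_allBlk : ∀ {n : ℕ} {σ : Fin n → L.Srt} {φ : Formula L (blk n σ Γ)} {ρ : Env A Γ},
    (allBlk n σ φ).Sat ρ ↔ ∀ a : (i : Fin n) → A.carrier (σ i), φ.Sat (Env.blk a ρ)
  | 0, _, _, _ => ⟨fun h _ => h, fun h => h fun i => i.elim0⟩
  | n + 1, σ, φ, _ => (sat_allBlk (n := n) (φ := all (σ 0) φ)).trans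
    ⟨fun h _ => h _ _, fun h a b => h (Fin.cons (α := fun i => A.carrier (σ i)) b a)⟩

theorem sat_exBlk : ∀ {n : ℕ} {σ : Fin n → L.Srt} {φ : Formula L (blk n σ Γ)} {ρ : Env A Γ},
    (exBlk n σ φ).Sat ρ ↔ ∃ a : (i : Fin n) → A.carrier (σ i), φ.Sat (Env.blk a ρ)
  | 0, _, _, _ => ⟨fun h => ⟨fun i => i.elim0, h⟩, fun h => h.choose_spec⟩
  | _ + 1, σ, _, _ => (sat_exBlk.trans (exists_congr fun _ => sat_ex)).trans
    ⟨fun ⟨a, b, h⟩ => ⟨Fin.cons (α := fun i => A.carrier (σ i)) b a, h⟩, fun ⟨_, h⟩ => ⟨_, _, h⟩⟩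

end Formula

end ManySorted

namespace PureVS

open ManySorted

variable {A : Structure.{u} sig} {Γ : List VSort}

theorem sat_allT {s : VSort} {n : ℕ} {φ : Fm (ext s n Γ)} {ρ : Env A Γ} :
    (allT s n φ).Sat ρ ↔ ∀ a : Fin n → A.carrier s, φ.Sat (Env.blk a ρ) :=
  Formula.sat_allBlk

theorem sat_exT {s : VSort} {n : ℕ} {φ : Fm (ext s n Γ)} {ρ : Env A Γ} :
    (exT s n φ).Sat ρ ↔ ∃ a : Fin n → A.carrier s, φ.Sat (Env.blk a ρ) :=
  Formula.sat_exBlk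

theorem blk_newT {s : VSort} {n : ℕ} (a : Fin n → A.carrier s) (ρ : Env A Γ) (i : Fin n) :
    Env.blk (σ := fun _ => s) a ρ s (newT i) = a i := Env.blk_new a ρ i

theorem blk_newMat {n : ℕ} (X : Fin (n * n) → A.carrier VSort.K) (ρ : Env A Γ) (a b : Fin n) :
    Env.blk (σ := fun _ => VSort.K) X ρ VSort.K (newMat a b) = X (finProdFinEquiv (a, b)) :=
  Env.blk_new X ρ _

theorem blk_oldT {s t : VSort} {n : ℕ} (a : Fin n → A.carrier s) (ρ : Env A Γ) (x : Var Γ t) :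
    Env.blk (σ := fun _ => s) a ρ t (oldT x) = ρ t x := Env.blk_old x a ρ

theorem cons_zero {s : VSort} (a : A.carrier s) (ρ : Env A Γ) :
    Env.cons (L := sig) a ρ s (Var.zero (S := VSort)) = a := rfl

theorem cons_succ {s t : VSort} (a : A.carrier s) (ρ : Env A Γ) (x : Var Γ t) :
    Env.cons (L := sig) a ρ t (Var.succ (S := VSort) x) = ρ t x := rfl

/-- The sorts `K` and `M` of the structure `A` are a field and a vector space over it. -/
class VSInterp (A : Structure.{u} sig) where
  field : Field (A.carrier VSort.K)
  addCommGroup : AddCommGroup (A.carrier VSort.M)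
  module : Module (A.carrier VSort.K) (A.carrier VSort.M)
  fn_zeroK : ∀ a, A.fn VFn.zeroK a = (0 : A.carrier VSort.K)
  fn_oneK : ∀ a, A.fn VFn.oneK a = (1 : A.carrier VSort.K)
  fn_addK : ∀ a : Fin 2 → A.carrier VSort.K, A.fn VFn.addK a = a 0 + a 1
  fn_mulK : ∀ a : Fin 2 → A.carrier VSort.K, A.fn VFn.mulK a = a 0 * a 1
  fn_zeroM : ∀ a, A.fn VFn.zeroM a = (0 : A.carrier VSort.M)
  fn_addM : ∀ a : Fin 2 → A.carrier VSort.M, A.fn VFn.addM a = a 0 + a 1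
  fn_smul : ∀ a : (i : Fin 2) → A.carrier (VFn.dom .smul i),
    A.fn VFn.smul a = (show A.carrier VSort.K from a 0) • (show A.carrier VSort.M from a 1)

attribute [reducible, instance] VSInterp.field VSInterp.addCommGroup VSInterp.module

theorem eval_var (ρ : Env A Γ) {s : VSort} (x : Var Γ s) : (Term.var (L := sig) x).eval ρ = ρ s x := rfl

theorem eval_v0 {s : VSort} (ρ : Env A (s :: Γ)) : (v0 : Term sig _ s).eval ρ = ρ s .zero := rfl

theorem eval_v1 {s t : VSort} (ρ : Env A (t :: s :: Γ)) :
    (v1 : Term sig _ s).eval ρ = ρ s (.succ .zero) := rfl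

theorem eval_v2 {s t r : VSort} (ρ : Env A (r :: t :: s :: Γ)) :
    (v2 : Term sig _ s).eval ρ = ρ s (.succ (.succ .zero)) := rfl

/-! ### Values of compound terms and formulas in a vector space -/

section Eval

variable [VSInterp A] (ρ : Env A Γ)

theorem eval_zeroK : (zeroK : KTerm Γ).eval ρ = 0 := VSInterp.fn_zeroK _

theorem eval_oneK : (oneK : KTerm Γ).eval ρ = 1 := VSInterp.fn_oneK _

theorem eval_addK (a b : KTerm Γ) : (addK a b).eval ρ = a.eval ρ + b.eval ρ :=
  VSInterp.fn_addK _

theorem eval_mulK (a b : KTerm Γ) : (mulK a b).eval ρ = a.eval ρ * b.eval ρ :=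
  VSInterp.fn_mulK _

theorem eval_zeroM : (zeroM : MTerm Γ).eval ρ = 0 := VSInterp.fn_zeroM _

theorem eval_addM (a b : MTerm Γ) : (addM a b).eval ρ = a.eval ρ + b.eval ρ :=
  VSInterp.fn_addM _

theorem eval_smul (a : KTerm Γ) (v : MTerm Γ) : (smul a v).eval ρ = a.eval ρ • v.eval ρ :=
  VSInterp.fn_smul _

theorem eval_sumK {n : ℕ} (a : Fin n → KTerm Γ) : (sumK a).eval ρ = ∑ i, (a i).eval ρ := by
  rw [sumK]
  induction n with
  | zero => simpa using eval_zeroK ρ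
  | succ n ih =>
    rw [List.ofFn_succ, List.foldr_cons, eval_addK, ih, Fin.sum_univ_succ]

theorem eval_sumM {n : ℕ} (a : Fin n → MTerm Γ) : (sumM a).eval ρ = ∑ i, (a i).eval ρ := by
  rw [sumM]
  induction n with
  | zero => simpa using eval_zeroM ρ
  | succ n ih =>
    rw [List.ofFn_succ, List.foldr_cons, eval_addM, ih, Fin.sum_univ_succ]

theorem eval_powK (a : KTerm Γ) (n : ℕ) : (powK a n).eval ρ = a.eval ρ ^ n := by
  induction n with
  | zero => rw [powK, eval_oneK, pow_zero]
  | succ n ih => rw [powK, eval_mulK, ih, pow_succ]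

theorem eval_numK (n : ℕ) : (numK n : KTerm Γ).eval ρ = n := by
  induction n with
  | zero => rw [numK, eval_zeroK, Nat.cast_zero]
  | succ n ih => rw [numK, eval_addK, ih, eval_oneK, Nat.cast_succ]

theorem eval_toKTerm {V : Type} (x : V → KTerm Γ) (t : FieldTerm V) :
    (t.toKTerm x).eval ρ = t.eval fun v => (x v).eval ρ := by
  induction t with
  | var v => rfl
  | zero => exact eval_zeroK ρ
  | one => exact eval_oneK ρ
  | add a b ha hb => rw [FieldTerm.toKTerm, eval_addK, ha, hb, FieldTerm.eval]
  | mul a b ha hb => rw [FieldTerm.toKTerm, eval_mulK, ha, hb, FieldTerm.eval]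

theorem sat_toFm {V : Type} (x : V → KTerm Γ) (θ : FieldQF V) :
    (θ.toFm x).Sat ρ ↔ θ.Sat fun v => (x v).eval ρ := by
  induction θ with
  | falsum => rfl
  | eq a b => rw [FieldQF.toFm, Formula.sat_eq, eval_toKTerm, eval_toKTerm, FieldQF.Sat]
  | imp φ ψ hφ hψ => rw [FieldQF.toFm, Formula.sat_imp, hφ, hψ, FieldQF.Sat]

theorem sat_inRowSpan {n : ℕ} {X : Fin n → Fin n → Var Γ VSort.K} {z : Fin n → Var Γ VSort.K} :
    (inRowSpan X z).Sat ρ ↔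
      (fun b => ρ VSort.K (z b)) ∈ rowSpan (K := A.carrier VSort.K) fun a b => ρ VSort.K (X a b) := by
  simp only [inRowSpan, sat_exT, Formula.sat_conj_ofFn, Formula.sat_eq, eval_var, eval_sumK,
    eval_mulK, blk_newT, blk_oldT, mem_rowSpan]

theorem sat_linIndep {n : ℕ} {v : Fin n → Var Γ VSort.M} :
    (linIndep v).Sat ρ ↔ LinearIndependent (A.carrier VSort.K) fun i => ρ VSort.M (v i) := by
  simp only [linIndep, sat_allT, Formula.sat_imp, Formula.sat_conj_ofFn, Formula.sat_eq, eval_var,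
    eval_sumM, eval_smul, eval_zeroM, eval_zeroK, blk_newT, blk_oldT]
  rw [Fintype.linearIndependent_iff]

theorem sat_spans {n : ℕ} {v : Fin n → Var Γ VSort.M} :
    (spans v).Sat ρ ↔
      Submodule.span (A.carrier VSort.K) (Set.range fun i => ρ VSort.M (v i)) = ⊤ := by
  simp only [spans, sat_exT, Formula.sat_all, Formula.sat_eq, eval_var,
    eval_sumM, eval_smul, blk_newT, blk_oldT, cons_zero, cons_succ]
  simp only [Submodule.eq_top_iff', Submodule.mem_span_range_iff_exists_fun]
  exact forall_congr' fun _ => exists_congr fun _ => eq_comm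

end Eval

theorem IsModel.union_iff {L : Signature} {A : Structure.{u} L} {S T : Set (Sentence L)} :
    IsModel A (S ∪ T) ↔ IsModel A S ∧ IsModel A T := by
  simp only [IsModel, Set.mem_union, or_imp, forall_and]

/-! ### Algebraic structure extracted from the axioms -/

section Extract

variable (A) (ρ : Env A Γ)

def opAddK (x y : A.carrier VSort.K) : A.carrier VSort.K :=
  A.fn VFn.addK fun i : Fin 2 => (![x, y] i : A.carrier VSort.K)

def opMulK (x y : A.carrier VSort.K) : A.carrier VSort.K :=
  A.fn VFn.mulK fun i : Fin 2 => (![x, y] i : A.carrier VSort.K)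

def opZeroK : A.carrier VSort.K := A.fn VFn.zeroK fun i : Fin 0 => i.elim0

def opOneK : A.carrier VSort.K := A.fn VFn.oneK fun i : Fin 0 => i.elim0

def opAddM (x y : A.carrier VSort.M) : A.carrier VSort.M :=
  A.fn VFn.addM fun i : Fin 2 => (![x, y] i : A.carrier VSort.M)

def opZeroM : A.carrier VSort.M := A.fn VFn.zeroM fun i : Fin 0 => i.elim0

def opSmul (x : A.carrier VSort.K) (v : A.carrier VSort.M) : A.carrier VSort.M :=
  A.fn VFn.smul fun i : Fin 2 => match i with
    | 0 => x
    | 1 => v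

variable {A}

theorem fn_addK_eq_op (a : Fin 2 → A.carrier VSort.K) :
    A.fn VFn.addK a = opAddK A (a 0) (a 1) :=
  congrArg (A.fn VFn.addK) (funext fun i : Fin 2 => by fin_cases i <;> rfl)

theorem fn_mulK_eq_op (a : Fin 2 → A.carrier VSort.K) :
    A.fn VFn.mulK a = opMulK A (a 0) (a 1) :=
  congrArg (A.fn VFn.mulK) (funext fun i : Fin 2 => by fin_cases i <;> rfl)

theorem fn_zeroK_eq_op (a : Fin 0 → A.carrier VSort.K) : A.fn VFn.zeroK a = opZeroK A :=
  congrArg (A.fn VFn.zeroK) (funext fun i : Fin 0 => i.elim0)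

theorem fn_oneK_eq_op (a : Fin 0 → A.carrier VSort.K) : A.fn VFn.oneK a = opOneK A :=
  congrArg (A.fn VFn.oneK) (funext fun i : Fin 0 => i.elim0)

theorem fn_addM_eq_op (a : Fin 2 → A.carrier VSort.M) :
    A.fn VFn.addM a = opAddM A (a 0) (a 1) :=
  congrArg (A.fn VFn.addM) (funext fun i : Fin 2 => by fin_cases i <;> rfl)

theorem fn_zeroM_eq_op (a : Fin 0 → A.carrier VSort.M) : A.fn VFn.zeroM a = opZeroM A :=
  congrArg (A.fn VFn.zeroM) (funext fun i : Fin 0 => i.elim0)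

theorem fn_smul_eq_op (a : (i : Fin 2) → A.carrier (VFn.dom .smul i)) :
    A.fn VFn.smul a = opSmul A (a 0) (a 1) :=
  congrArg (A.fn VFn.smul) (funext fun i : Fin 2 => by fin_cases i <;> rfl)

theorem eval_addK_eq_op (a b : KTerm Γ) :
    (addK a b).eval ρ = opAddK A (a.eval ρ) (b.eval ρ) := fn_addK_eq_op _

theorem eval_mulK_eq_op (a b : KTerm Γ) :
    (mulK a b).eval ρ = opMulK A (a.eval ρ) (b.eval ρ) := fn_mulK_eq_op _

theorem eval_zeroK_eq_op : (zeroK : KTerm Γ).eval ρ = opZeroK A := fn_zeroK_eq_op _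

theorem eval_oneK_eq_op : (oneK : KTerm Γ).eval ρ = opOneK A := fn_oneK_eq_op _

theorem eval_addM_eq_op (a b : MTerm Γ) :
    (addM a b).eval ρ = opAddM A (a.eval ρ) (b.eval ρ) := fn_addM_eq_op _

theorem eval_zeroM_eq_op : (zeroM : MTerm Γ).eval ρ = opZeroM A := fn_zeroM_eq_op _

theorem eval_smul_eq_op (a : KTerm Γ) (v : MTerm Γ) :
    (smul a v).eval ρ = opSmul A (a.eval ρ) (v.eval ρ) := fn_smul_eq_op _

theorem exists_field_of_isModel (h : IsModel A fieldAxioms) :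
    ∃ F : Field (A.carrier VSort.K), F.zero = opZeroK A ∧ F.one = opOneK A ∧
      F.add = opAddK A ∧ F.mul = opMulK A := by
  simp only [IsModel, fieldAxioms, Set.forall_mem_insert, Set.mem_singleton_iff, forall_eq,
    Formula.sat_all, Formula.sat_eq, Formula.sat_ex, Formula.sat_not, Formula.sat_imp,
    eval_addK_eq_op, eval_mulK_eq_op, eval_zeroK_eq_op, eval_oneK_eq_op, eval_v0, eval_v1, eval_v2,
    cons_zero, cons_succ] at h
  obtain ⟨add_assoc, add_comm, add_zero, add_neg, mul_assoc, mul_comm, mul_one, mul_add, ne,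
    mul_inv⟩ := h
  choose neg hneg using add_neg
  -- The axioms leave the inverse of zero open, whereas `Field` needs it to be zero.
  have hinv : ∀ x : A.carrier VSort.K, ∃ y, (¬ x = opZeroK A → opMulK A x y = opOneK A) ∧
      (x = opZeroK A → y = opZeroK A) := by
    intro x
    by_cases hx : x = opZeroK A
    · exact ⟨opZeroK A, fun h => absurd hx h, fun _ => rfl⟩
    · obtain ⟨y, hy⟩ := mul_inv x hx
      exact ⟨y, fun _ => hy, fun h => absurd h hx⟩
  choose inv hinv hinv0 using hinv
  let : Zero (A.carrier VSort.K) := ⟨opZeroK A⟩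
  let : One (A.carrier VSort.K) := ⟨opOneK A⟩
  let : Add (A.carrier VSort.K) := ⟨opAddK A⟩
  let : Mul (A.carrier VSort.K) := ⟨opMulK A⟩
  let : Neg (A.carrier VSort.K) := ⟨neg⟩
  let : Inv (A.carrier VSort.K) := ⟨inv⟩
  refine ⟨Field.ofMinimalAxioms (A.carrier VSort.K) ?_ ?_ ?_ ?_ ?_ ?_ ?_ ?_ ?_ ?_, ?_⟩
  -- The variable `v0` is bound by the innermost quantifier, so the arguments come in reverse order.
  · exact fun x y z => add_assoc z y x
  · exact fun x => (add_comm _ _).trans (add_zero x)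
  · exact fun x => (add_comm _ _).trans (hneg x)
  · exact fun x y z => mul_assoc z y x
  · exact fun x y => mul_comm y x
  · exact fun x => (mul_comm _ _).trans (mul_one x)
  · exact fun x hx => hinv x hx
  · exact hinv0 _ rfl
  · exact fun x y z => mul_add z y x
  · exact ⟨_, _, ne⟩
  · exact ⟨rfl, rfl, rfl, rfl⟩

theorem nonempty_vsInterp_of_isModel (h : IsModel A fieldAxioms)
    (h' : IsModel A vectorSpaceAxioms) : Nonempty (VSInterp A) := by
  obtain ⟨F, hzero, hone, hadd, hmul⟩ := exists_field_of_isModel h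
  have hadd' : ∀ x y : A.carrier VSort.K, x + y = opAddK A x y := fun x y => congrFun₂ hadd x y
  have hmul' : ∀ x y : A.carrier VSort.K, x * y = opMulK A x y := fun x y => congrFun₂ hmul x y
  have hone' : (1 : A.carrier VSort.K) = opOneK A := hone
  simp only [IsModel, vectorSpaceAxioms, Set.forall_mem_insert, Set.mem_singleton_iff, forall_eq,
    Formula.sat_all, Formula.sat_eq, Formula.sat_ex,
    eval_addK_eq_op, eval_mulK_eq_op, eval_oneK_eq_op, eval_v0, eval_v1, eval_v2,
    eval_addM_eq_op, eval_zeroM_eq_op, eval_smul_eq_op, cons_zero, cons_succ] at h'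
  obtain ⟨add_assoc, add_comm, add_zero, add_neg, smul_add, add_smul, mul_smul, one_smul⟩ := h'
  choose neg hneg using add_neg
  let : Zero (A.carrier VSort.M) := ⟨opZeroM A⟩
  let : Add (A.carrier VSort.M) := ⟨opAddM A⟩
  let : Neg (A.carrier VSort.M) := ⟨neg⟩
  let G : AddGroup (A.carrier VSort.M) := AddGroup.ofLeftAxioms (fun x y z => add_assoc z y x)
    (fun x => (add_comm _ _).trans (add_zero x)) (fun x => (add_comm _ _).trans (hneg x))
  let C : AddCommGroup (A.carrier VSort.M) := { G with add_comm := fun x y => add_comm y x }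
  let : SMul (A.carrier VSort.K) (A.carrier VSort.M) := ⟨opSmul A⟩
  let M : Module (A.carrier VSort.K) (A.carrier VSort.M) := Module.ofMinimalAxioms
    (fun r x y => smul_add y x r)
    (fun r s x => (congrArg (opSmul A · x) (hadd' r s)).trans (add_smul x s r))
    (fun r s x => (congrArg (opSmul A · x) (hmul' r s)).trans (mul_smul x s r))
    (fun x => (congrArg (opSmul A · x) hone').trans (one_smul x))
  exact ⟨{
    field := F
    addCommGroup := C
    module := M
    fn_zeroK := fun a => (fn_zeroK_eq_op a).trans hzero.symm
    fn_oneK := fun a => (fn_oneK_eq_op a).trans hone.symm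
    fn_addK := fun a => (fn_addK_eq_op a).trans (hadd' _ _).symm
    fn_mulK := fun a => (fn_mulK_eq_op a).trans (hmul' _ _).symm
    fn_zeroM := fn_zeroM_eq_op
    fn_addM := fn_addM_eq_op
    fn_smul := fn_smul_eq_op }⟩

end Extract

/-! ### Semantic content of the axioms -/

theorem forall_matrix_iff {n : ℕ} {K : Type*} {p : (Fin n × Fin n → K) → Prop} :
    (∀ X : Fin (n * n) → K, p fun ab => X (finProdFinEquiv ab)) ↔ ∀ X, p X :=
  ((Equiv.arrowCongr finProdFinEquiv.symm (Equiv.refl K)).forall_congr fun _ => Iff.rfl)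

theorem exists_matrix_iff {n : ℕ} {K : Type*} {p : (Fin n × Fin n → K) → Prop} :
    (∃ X : Fin (n * n) → K, p fun ab => X (finProdFinEquiv ab)) ↔ ∃ X, p X :=
  ((Equiv.arrowCongr finProdFinEquiv.symm (Equiv.refl K)).exists_congr fun _ => Iff.rfl)

theorem eval_piG (ρ : Env A Γ) {i : ℕ+} (X : Fin i → Fin i → KTerm Γ) :
    (piG i X).eval ρ = A.fn (VFn.pi i) fun ab : Fin i × Fin i => (X ab.1 ab.2).eval ρ := rfl

theorem eval_DG (ρ : Env A Γ) {i : ℕ+} (v : Fin i → MTerm Γ) :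
    (DG i v).eval ρ = A.fn (VFn.D i) fun a : Fin i => (v a).eval ρ := rfl

theorem sat_piSurjective {i : ℕ+} :
    (piSurjective i).Sat (Env.nil : Env A []) ↔
      ∀ g : A.carrier (VSort.G i), ∃ X : Fin i × Fin i → A.carrier VSort.K,
        A.fn (VFn.pi i) X = g := by
  simp only [piSurjective, Formula.sat_all, sat_exT, Formula.sat_eq, eval_piG, eval_var, blk_newMat,
    blk_oldT, cons_zero]
  exact forall_congr' fun g =>
    exists_matrix_iff (p := fun X : Fin i × Fin i → A.carrier VSort.K => A.fn (VFn.pi i) X = g)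

theorem sat_predP (ρ : Env A Γ) (R : PartQF) (p : (j : Fin R.m) → GTerm Γ (R.k j))
    (x : Fin R.l → KTerm Γ) :
    (predP R p x).Sat ρ ↔ A.rel R (Sum.rec (fun j => (p j).eval ρ) fun a => (x a).eval ρ) := by
  refine iff_of_eq (congrArg (A.rel R) (funext fun i => ?_))
  rcases i with j | a <;> rfl

section VS

variable [VSInterp A]

/-- The row span of a matrix, given as a function of pairs of indices. -/
def matSpan {n : Type} {K : Type u} [Field K] (X : n × n → K) : Submodule K (n → K) :=
  rowSpan fun a b => X (a, b)

theorem sat_piFibres {i : ℕ+} :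
    (piFibres i).Sat (Env.nil : Env A []) ↔
      ∀ X Y : Fin i × Fin i → A.carrier VSort.K,
        A.fn (VFn.pi i) X = A.fn (VFn.pi i) Y ↔ matSpan X = matSpan Y := by
  simp only [piFibres, sat_allT, Formula.sat_iff, Formula.sat_eq, eval_piG, eval_var, blk_newMat,
    blk_oldT, sat_inRowSpan, blk_newT]
  rw [← forall_matrix_iff]
  refine forall_congr' fun X => ?_
  rw [← forall_matrix_iff]
  refine forall_congr' fun Y => ?_
  rw [SetLike.ext_iff (p := matSpan _)]
  rfl

theorem sat_dAxiom {i : ℕ+} :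
    (dAxiom i).Sat (Env.nil : Env A []) ↔
      ∀ (v : Fin i → A.carrier VSort.M) (X : Fin i × Fin i → A.carrier VSort.K),
        A.fn (VFn.pi i) X = A.fn (VFn.D i) v →
          ∀ z : Fin i → A.carrier VSort.K, z ∈ matSpan X ↔ ∑ a, z a • v a = 0 := by
  simp only [dAxiom, sat_allT, Formula.sat_imp, Formula.sat_iff, Formula.sat_eq, eval_piG, eval_DG,
    eval_var, blk_newMat, blk_oldT, sat_inRowSpan, blk_newT, eval_sumM, eval_smul, eval_zeroM]
  refine forall_congr' fun v => ?_
  rw [← forall_matrix_iff]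
  rfl

theorem sat_pAxiom {R : PartQF} :
    (pAxiom R).Sat (Env.nil : Env A []) ↔
      ∀ args : (i : Fin R.m ⊕ Fin R.l) → A.carrier (sig.relDom R i),
        A.rel R args ↔ ∃ X : (Σ j : Fin R.m, Fin (R.k j) × Fin (R.k j)) → A.carrier VSort.K,
          R.φ.Sat (Sum.elim X fun a => args (.inr a)) ∧
            ∀ j, A.fn (VFn.pi (R.k j)) (fun ab => X ⟨j, ab⟩) = args (.inl j) := by
  simp only [pAxiom, Formula.sat_allBlk, sat_allT, sat_exT, Formula.sat_iff, Formula.sat_and,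
    Formula.sat_conj_ofFn, sat_toFm, Formula.sat_eq, eval_piG, eval_var, sat_predP, blk_newT,
    blk_oldT]
  refine Iff.trans (b := ∀ args : (i : Fin R.m ⊕ Fin R.l) → A.carrier (sig.relDom R i), _)
    ⟨fun h args => h (fun j => args (.inl j)) (fun a => args (.inr a)),
      fun h p x => h (Sum.rec p x)⟩ (forall_congr' fun args => ?_)
  let e := Fintype.equivFin (Σ j : Fin R.m, Fin (R.k j) × Fin (R.k j))
  refine iff_congr (iff_of_eq (congrArg (A.rel R) (funext fun i => ?_)))
    ((Equiv.arrowCongr e.symm (Equiv.refl _)).exists_congr fun a => and_congr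
      (iff_of_eq (congrArg (fun x => R.φ.Sat x) (funext fun v => ?_)))
      (forall_congr' fun j => ?_))
  · rcases i with j | a
    · exact Env.blk_new _ _ j
    · rfl
  · rcases v with c | b
    · exact blk_newT _ _ _
    · exact (blk_oldT _ _ _).trans (blk_newT _ _ _)
  · exact iff_of_eq (congrArg (_ = ·) (Env.blk_new _ _ j))

theorem isModel_rootAxiom_iff :
    IsModel A (Set.range rootAxiom) ↔ IsAlgClosed (A.carrier VSort.K) := by
  simp only [IsModel, Set.forall_mem_range, rootAxiom, sat_allT, Formula.sat_ex, Formula.sat_eq,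
    eval_addK, eval_powK, eval_sumK, eval_mulK, eval_var, eval_v0, eval_zeroK, cons_zero, cons_succ,
    blk_newT]
  open Polynomial in
  constructor
  · intro h
    refine IsAlgClosed.of_exists_root _ fun p hp hirr => ?_
    obtain ⟨n, hn⟩ := Nat.exists_eq_succ_of_ne_zero hirr.natDegree_pos.ne'
    obtain ⟨x, hx⟩ := h n fun i => p.coeff i
    refine ⟨x, ?_⟩
    rw [eval_eq_sum_range, hn, Finset.sum_range_succ, Finset.sum_range, ← hx, ← Nat.succ_eq_add_one,
      ← hn, hp.coeff_natDegree, one_mul, add_comm]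
  · intro h n a
    let q : (A.carrier VSort.K)[X] := X ^ (n + 1) + ∑ i : Fin (n + 1), C (a i) * X ^ (i : ℕ)
    have hq : q.degree = (n + 1 : ℕ) := by
      rw [degree_add_eq_left_of_degree_lt, degree_X_pow]
      rw [degree_X_pow]
      exact degree_sum_fin_lt a
    obtain ⟨x, hx⟩ := IsAlgClosed.exists_root q (by rw [hq]; exact_mod_cast n.succ_ne_zero)
    refine ⟨x, ?_⟩
    simpa [q, eval_finsetSum] using hx

/-- `M` has dimension `d` over `K`. -/
def HasDim (A : Structure.{u} sig) [VSInterp A] : ℕ∞ → Prop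
  | (d : ℕ) => Module.Finite (A.carrier VSort.K) (A.carrier VSort.M) ∧
      Module.finrank (A.carrier VSort.K) (A.carrier VSort.M) = d
  | ⊤ => ¬ Module.Finite (A.carrier VSort.K) (A.carrier VSort.M)

theorem isModel_dimAxioms_iff {d : ℕ∞} : IsModel A (dimAxioms d) ↔ HasDim A d := by
  cases d with
  | coe d =>
    simp only [IsModel, dimAxioms, HasDim, Set.mem_singleton_iff, forall_eq, sat_exT,
      Formula.sat_and, sat_linIndep, sat_spans, blk_newT]
    constructor
    · rintro ⟨v, hv, hs⟩
      let b := Module.Basis.mk hv hs.ge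
      exact ⟨.of_basis b, by simpa using Module.finrank_eq_card_basis b⟩
    · rintro ⟨_, hd⟩
      let b := Module.finBasisOfFinrankEq _ _ hd
      exact ⟨b, b.linearIndependent, b.span_eq⟩
  | top =>
    have h : IsModel A (dimAxioms ⊤) ↔
        ∀ n, ∃ v : Fin n → A.carrier VSort.M, LinearIndependent (A.carrier VSort.K) v := by
      refine Set.forall_mem_range.trans (forall_congr' fun n => ?_)
      simp only [sat_exT, sat_linIndep, blk_newT]
    rw [h]
    change _ ↔ ¬ Module.Finite (A.carrier VSort.K) (A.carrier VSort.M)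
    constructor
    · intro h _
      -- One independent vector more than a finite dimension would allow.
      obtain ⟨v, hv⟩ := h (Module.finrank (A.carrier VSort.K) (A.carrier VSort.M) + 1)
      simpa using hv.fintype_card_le_finrank
    · intro h n
      refine exists_linearIndependent_of_le_rank ?_
      rw [← Module.rank_lt_aleph0_iff, not_lt] at h
      exact (Cardinal.natCast_le_aleph0).trans h

theorem isModel_charAxioms_iff {p : ℕ} (hp : p = 0 ∨ p.Prime) :
    IsModel A (charAxioms p) ↔ CharP (A.carrier VSort.K) p := by
  rw [charAxioms]
  split_ifs with h
  · subst h
    simp only [IsModel, Set.mem_ofPred_eq, forall_exists_index, and_imp]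
    constructor
    · intro h
      obtain ⟨q, hq⟩ := CharP.exists (A.carrier VSort.K)
      rcases CharP.char_is_prime_or_zero (A.carrier VSort.K) q with hq' | rfl
      · refine absurd ?_ (h _ q hq' rfl)
        rw [Formula.sat_eq, eval_numK, eval_zeroK, CharP.cast_eq_zero]
      · exact hq
    · rintro h _ q hq rfl
      rw [Formula.sat_not, Formula.sat_eq, eval_numK, eval_zeroK,
        CharP.cast_eq_zero_iff (A.carrier VSort.K) 0, zero_dvd_iff]
      exact hq.ne_zero
  · simp only [IsModel, Set.mem_singleton_iff, forall_eq, Formula.sat_eq, eval_numK, eval_zeroK]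
    exact (CharP.charP_iff_prime_eq_zero (hp.resolve_left h)).symm

end VS

/-! ### Models of the theory and their subspaces -/

/-- The sort `K` of `A` is an algebraically closed field, `M` is a vector space over it, the sorts
`G i` are identified with sets of subspaces, and the other symbols have their intended meaning. -/
class GrInterp (A : Structure.{u} sig) extends VSInterp A where
  isAlgClosed : IsAlgClosed (A.carrier VSort.K)
  sub : ∀ {i : ℕ+}, A.carrier (VSort.G i) → Submodule (A.carrier VSort.K) (Fin i → A.carrier VSort.K)
  sub_injective : ∀ i : ℕ+, Function.Injective (sub (i := i))
  sub_pi : ∀ (i : ℕ+) (X : Fin i × Fin i → A.carrier VSort.K),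
    sub (A.fn (VFn.pi i) X) = matSpan X
  mem_sub_D : ∀ (i : ℕ+) (v : Fin i → A.carrier VSort.M) (z : Fin i → A.carrier VSort.K),
    z ∈ sub (A.fn (VFn.D i) v) ↔ ∑ a, z a • v a = 0
  rel_iff : ∀ (R : PartQF) (args : (i : Fin R.m ⊕ Fin R.l) → A.carrier (sig.relDom R i)),
    A.rel R args ↔ ∃ X : (Σ j : Fin R.m, Fin (R.k j) × Fin (R.k j)) → A.carrier VSort.K,
      R.φ.Sat (Sum.elim X fun a => args (.inr a)) ∧
        ∀ j, (matSpan fun ab => X ⟨j, ab⟩) = sub (show A.carrier (VSort.G (R.k j)) from args (.inl j))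

attribute [instance] GrInterp.isAlgClosed

theorem exists_matSpan_eq {n : Type} [Finite n] {K : Type u} [Field K] (U : Submodule K (n → K)) :
    ∃ X : n × n → K, matSpan X = U := by
  obtain ⟨X, hX⟩ := exists_rowSpan_eq U
  exact ⟨fun ab => X ab.1 ab.2, hX⟩

/-- Surjectivity of `π` lets every element of `G i` be read as the row span of a chosen matrix; the
axiom on fibres makes this reading injective and independent of the choice. -/
theorem exists_grInterp_of_isModel {d : ℕ∞} (h : IsModel A (theoryACF d)) :
    ∃ _ : GrInterp A, HasDim A d := by
  simp only [theoryACF, baseTheory, IsModel.union_iff] at h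
  obtain ⟨⟨⟨⟨⟨⟨⟨hfield, hvs⟩, hsurj⟩, hfib⟩, hP⟩, hD⟩, hroot⟩, hdim⟩ := h
  obtain ⟨hA⟩ := nonempty_vsInterp_of_isModel hfield hvs
  simp only [IsModel, Set.forall_mem_range, sat_piSurjective] at hsurj
  simp only [IsModel, Set.forall_mem_range, sat_piFibres] at hfib
  simp only [IsModel, Set.forall_mem_range, sat_pAxiom] at hP
  simp only [IsModel, Set.forall_mem_range, sat_dAxiom] at hD
  choose X hX using hsurj
  have hpi : ∀ (i : ℕ+) (Y : Fin i × Fin i → A.carrier VSort.K) (g : A.carrier (VSort.G i)),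
      A.fn (VFn.pi i) Y = g ↔ matSpan Y = matSpan (X i g) := by
    intro i Y g
    rw [← hfib, hX]
  refine ⟨{ hA with
    isAlgClosed := isModel_rootAxiom_iff.mp hroot
    sub := fun {i} g => matSpan (X i g)
    sub_injective := fun i g g' hg => ?_
    sub_pi := fun i Y => ((hpi i Y _).mp rfl).symm
    mem_sub_D := fun i v => hD i v _ (hX i _)
    rel_iff := fun R args => ?_ }, isModel_dimAxioms_iff.mp hdim⟩
  · exact (hX i g).symm.trans ((hpi i _ g').mpr hg)
  · rw [hP]
    exact exists_congr fun Y => and_congr_right fun _ => forall_congr' fun j => hpi _ _ _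

theorem isModel_fieldAxioms [VSInterp A] : IsModel A fieldAxioms := by
  simp only [IsModel, fieldAxioms, Set.forall_mem_insert, Set.mem_singleton_iff, forall_eq,
    Formula.sat_all, Formula.sat_eq, Formula.sat_ex, Formula.sat_not, Formula.sat_imp,
    eval_addK, eval_mulK, eval_zeroK, eval_oneK, eval_v0, eval_v1, eval_v2,
    cons_zero, cons_succ]
  refine ⟨fun _ _ _ => add_assoc _ _ _, fun _ _ => add_comm _ _, add_zero,
    fun a => ⟨-a, add_neg_cancel a⟩, fun _ _ _ => mul_assoc _ _ _, fun _ _ => mul_comm _ _,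
    mul_one, fun _ _ _ => mul_add _ _ _, zero_ne_one, fun a ha => ⟨a⁻¹, mul_inv_cancel₀ ha⟩⟩

theorem isModel_vectorSpaceAxioms [VSInterp A] : IsModel A vectorSpaceAxioms := by
  simp only [IsModel, vectorSpaceAxioms, Set.forall_mem_insert, Set.mem_singleton_iff, forall_eq,
    Formula.sat_all, Formula.sat_eq, Formula.sat_ex, eval_addK, eval_mulK, eval_oneK, eval_v0,
    eval_v1, eval_v2, eval_addM, eval_zeroM, eval_smul, cons_zero, cons_succ]
  refine ⟨fun _ _ _ => add_assoc _ _ _, fun _ _ => add_comm _ _, add_zero,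
    fun a => ⟨-a, add_neg_cancel a⟩, fun _ _ _ => smul_add _ _ _, fun _ _ _ => add_smul _ _ _,
    fun _ _ _ => mul_smul _ _ _, one_smul _⟩

theorem isModel_theoryACF [GrInterp A] {d : ℕ∞} (hd : HasDim A d) : IsModel A (theoryACF d) := by
  simp only [theoryACF, baseTheory, IsModel.union_iff]
  have hpi : ∀ (i : ℕ+) (Y : Fin i × Fin i → A.carrier VSort.K) (g : A.carrier (VSort.G i)),
      A.fn (VFn.pi i) Y = g ↔ matSpan Y = GrInterp.sub g := by
    intro i Y g
    rw [← (GrInterp.sub_injective i).eq_iff, GrInterp.sub_pi]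
  refine ⟨⟨⟨⟨⟨⟨⟨isModel_fieldAxioms, isModel_vectorSpaceAxioms⟩, ?_⟩, ?_⟩, ?_⟩, ?_⟩,
    isModel_rootAxiom_iff.mpr inferInstance⟩, isModel_dimAxioms_iff.mpr hd⟩
  · simp only [IsModel, Set.forall_mem_range, sat_piSurjective]
    intro i g
    obtain ⟨X, hX⟩ := exists_matSpan_eq (GrInterp.sub g)
    exact ⟨X, (hpi i X g).mpr hX⟩
  · simp only [IsModel, Set.forall_mem_range, sat_piFibres]
    intro i X Y
    rw [hpi, GrInterp.sub_pi]
  · simp only [IsModel, Set.forall_mem_range, sat_pAxiom]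
    intro R args
    rw [GrInterp.rel_iff]
    exact exists_congr fun Y => and_congr_right fun _ => forall_congr' fun j => (hpi _ _ _).symm
  · simp only [IsModel, Set.forall_mem_range, sat_dAxiom]
    intro i v X hX z
    rw [(hpi _ _ _).mp hX, GrInterp.mem_sub_D]

/-! ### Standard structures and consistency -/

section StandardModel

variable (K M : Type u) [Field K] [AddCommGroup M] [Module K M]

/-- The carriers of the standard structure attached to a vector space. -/
abbrev stdCarrier : VSort → Type u
  | .K => K
  | .M => M
  | .G i => Submodule K (Fin i → K)

/-- The interpretation of the function symbols in the standard structure. -/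
def stdFn : {s : VSort} → (f : VFn s) → ((i : f.Idx) → stdCarrier K M (f.dom i)) →
    stdCarrier K M s
  | _, .zeroK => fun _ => (0 : K)
  | _, .oneK => fun _ => (1 : K)
  | _, .addK => fun a => (a 0 + a 1 : K)
  | _, .mulK => fun a => (a 0 * a 1 : K)
  | _, .zeroM => fun _ => (0 : M)
  | _, .addM => fun a => (a 0 + a 1 : M)
  | _, .smul => fun a => ((show K from a 0) • (show M from a 1) : M)
  | _, .pi _ => fun X => matSpan X
  | _, .D i => fun v => LinearMap.ker (Fintype.linearCombination K (M := M) (α := Fin i) v)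

/-- The standard structure attached to a vector space. -/
def stdStructure : Structure.{u} sig where
  carrier := stdCarrier K M
  fn := stdFn K M
  rel R args := ∃ X : (Σ j : Fin R.m, Fin (R.k j) × Fin (R.k j)) → K,
    R.φ.Sat (Sum.elim X fun a => args (.inr a)) ∧
      ∀ j, (matSpan fun ab => X ⟨j, ab⟩) = (args (.inl j) : Submodule K (Fin (R.k j) → K))

/-- The interpretation of the symbols in the standard structure. -/
@[reducible]
def stdInterp [IsAlgClosed K] : GrInterp (stdStructure K M) where
  field := inferInstanceAs (Field K)
  addCommGroup := inferInstanceAs (AddCommGroup M)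
  module := inferInstanceAs (Module K M)
  fn_zeroK _ := rfl
  fn_oneK _ := rfl
  fn_addK _ := rfl
  fn_mulK _ := rfl
  fn_zeroM _ := rfl
  fn_addM _ := rfl
  fn_smul _ := rfl
  isAlgClosed := inferInstanceAs (IsAlgClosed K)
  sub {i} g := (g : Submodule K (Fin i → K))
  sub_injective _ := fun _ _ h => h
  sub_pi _ _ := rfl
  mem_sub_D i v z := LinearMap.mem_ker (R := K) (M₂ := M)
    (f := Fintype.linearCombination K (M := M) (α := Fin i) v) (y := z)
  rel_iff _ _ := Iff.rfl

end StandardModel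

theorem exists_isAlgClosed_charP {p : ℕ} (hp : p = 0 ∨ p.Prime) :
    ∃ (K : Type u) (_ : Field K), IsAlgClosed K ∧ CharP K p := by
  rcases hp with rfl | hp
  · have : CharZero (ULift.{u} ℚ) := ⟨fun a b h => by
      simpa using congrArg ULift.down h⟩
    exact ⟨AlgebraicClosure (ULift.{u} ℚ), inferInstance, inferInstance,
      charP_of_injective_algebraMap (algebraMap (ULift.{u} ℚ) _).injective 0⟩
  · have : Fact p.Prime := ⟨hp⟩
    exact ⟨AlgebraicClosure (ULift.{u} (ZMod p)), inferInstance, inferInstance,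
      charP_of_injective_algebraMap (algebraMap (ULift.{u} (ZMod p)) _).injective p⟩

theorem exists_model (d : ℕ∞) {p : ℕ} (hp : p = 0 ∨ p.Prime) :
    ∃ A : Structure.{u} sig, IsModel A (theoryACF d ∪ charAxioms p) := by
  obtain ⟨K, _, _, hK⟩ := exists_isAlgClosed_charP.{u} hp
  cases d with
  | coe d =>
    let := stdInterp K (Fin d → K)
    refine ⟨stdStructure K (Fin d → K), IsModel.union_iff.mpr ⟨isModel_theoryACF ?_,
      (isModel_charAxioms_iff hp).mpr hK⟩⟩
    exact ⟨inferInstanceAs (Module.Finite K (Fin d → K)), Module.finrank_fin_fun K⟩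
  | top =>
    let := stdInterp K (ℕ →₀ K)
    refine ⟨stdStructure K (ℕ →₀ K), IsModel.union_iff.mpr ⟨isModel_theoryACF ?_,
      (isModel_charAxioms_iff hp).mpr hK⟩⟩
    change ¬ Module.Finite K (ℕ →₀ K)
    intro h
    have := (Finsupp.basisSingleOne (R := K) (ι := ℕ)).linearIndependent.finite
    exact not_finite ℕ

/-! ### Variables of a context -/

instance finite_sigma_var (Γ : List VSort) : Finite (Σ s, Var Γ s) := by
  induction Γ with
  | nil => exact @Finite.of_subsingleton _ ⟨fun x => nomatch x.2⟩
  | cons t Γ ih =>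
    let f : (Σ s, Var (t :: Γ) s) → Option (Σ s, Var Γ s) := fun x => match x with
      | ⟨_, .zero⟩ => none
      | ⟨s, .succ y⟩ => some ⟨s, y⟩
    refine Finite.of_injective f ?_
    rintro ⟨_, _ | x⟩ ⟨_, _ | y⟩ h
    · rfl
    · cases h
    · cases h
    · cases h; rfl

instance finite_var (Γ : List VSort) (s : VSort) : Finite (Var Γ s) :=
  Finite.of_injective (fun x => (⟨s, x⟩ : Σ s, Var Γ s)) sigma_mk_injective

noncomputable instance fintype_var (Γ : List VSort) (s : VSort) : Fintype (Var Γ s) :=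
  Fintype.ofFinite _

instance finite_sigma_varG (Γ : List VSort) : Finite (Σ i : ℕ+, Var Γ (VSort.G i)) :=
  Finite.of_injective (fun x => (⟨.G x.1, x.2⟩ : Σ s, Var Γ s)) (by
    rintro ⟨i, x⟩ ⟨j, y⟩ h
    cases h; rfl)

/-- The extension of a tuple indexed by the variables of a context by zero. -/
def extZero {Γ : List VSort} {s t : VSort} {K : Type u} [Zero K] (z : Var Γ t → K) :
    Var (s :: Γ) t → K
  | .zero => 0
  | .succ x => z x

theorem sum_var_cons_self {N : Type*} [AddCommMonoid N] {Γ : List VSort} {t : VSort}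
    (f : Var (t :: Γ) t → N) : ∑ y, f y = f .zero + ∑ x, f (.succ x) := by
  let e : Option (Var Γ t) ≃ Var (t :: Γ) t :=
    { toFun := fun o => match o with
        | none => .zero
        | some x => .succ x
      invFun := fun y => match y with
        | .zero => none
        | .succ x => some x
      left_inv := by rintro (_ | x) <;> rfl
      right_inv := by rintro (_ | x) <;> rfl }
  rw [← e.sum_comp, Fintype.sum_option]
  rfl

theorem sum_var_cons_of_ne {N : Type*} [AddCommMonoid N] {Γ : List VSort} {s t : VSort} (h : s ≠ t)
    (f : Var (s :: Γ) t → N) : ∑ y, f y = ∑ x, f (.succ x) := by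
  let e : Var Γ t ≃ Var (s :: Γ) t :=
    Equiv.ofBijective Var.succ ⟨fun x y h => by cases h; rfl, fun y => by
      cases y with
      | zero => exact absurd rfl h
      | succ x => exact ⟨x, rfl⟩⟩
  rw [← e.sum_comp]
  rfl

/-- The zero coefficient discards the new variable when it has the sort summed over; otherwise there
is no new summand. -/
theorem sum_extZero_smul {K N : Type u} [Field K] [AddCommGroup N] [Module K N] {Γ : List VSort}
    {s t : VSort} (z : Var Γ t → K) (f : Var (s :: Γ) t → N) :
    ∑ y, extZero (s := s) z y • f y = ∑ x, z x • f (.succ x) := by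
  by_cases h : s = t
  · subst h
    rw [sum_var_cons_self]
    simp [extZero]
  · rw [sum_var_cons_of_ne h]
    rfl

/-! ### Coordinates of assignments -/

/-- The index set of the coordinates of an assignment to the variables of `Γ`: the values of the
variables of the sort `K`, matrices representing the values of the variables of the sorts `G i`, and
a matrix representing the linear relations between the values of the variables of the sort `M`. -/
abbrev Idx (Γ : List VSort) : Type :=
  Var Γ VSort.K ⊕ (Σ p : (Σ i : ℕ+, Var Γ (VSort.G i)), Fin p.1 × Fin p.1) ⊕
    (Var Γ VSort.M × Var Γ VSort.M)

section Coordinates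

variable {K : Type u} [Field K]

/-- The subspace of `K^i` given by the coordinates of a variable of the sort `G i`. -/
def gPart (X : Idx Γ → K) (p : Σ i : ℕ+, Var Γ (VSort.G i)) : Submodule K (Fin p.1 → K) :=
  matSpan fun ab => X (.inr (.inl ⟨p, ab⟩))

/-- The space of linear relations between the variables of the sort `M`. -/
def mPart (X : Idx Γ → K) : Submodule K (Var Γ VSort.M → K) :=
  matSpan fun ab => X (.inr (.inr ab))

/-- The codimension of `U` in `K^C` is at most `d`. -/
def CodimLE {C : Type} (U : Submodule K (C → K)) : ℕ∞ → Prop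
  | (d : ℕ) => ∃ t : Fin d × C → K, ∀ z : C → K, ∃ c : Fin d → K,
      (fun b => z b + ∑ a, c a * t (a, b)) ∈ U
  | ⊤ => True

/-- The coordinates `Z` extend the coordinates `X` by those of one more variable. -/
def Compat (d : ℕ∞) {s : VSort} (X : Idx Γ → K) (Z : Idx (s :: Γ) → K) : Prop :=
  (∀ x : Var Γ VSort.K, Z (.inl x.succ) = X (.inl x)) ∧
    (∀ p : (Σ i : ℕ+, Var Γ (VSort.G i)), gPart Z ⟨p.1, p.2.succ⟩ = gPart X p) ∧
      (∀ z, z ∈ mPart X ↔ extZero z ∈ mPart Z) ∧ CodimLE (mPart Z) d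

end Coordinates

section Rep

variable [GrInterp A]

/-- The linear relations between the values of the variables of the sort `M`. -/
noncomputable def relations (ρ : Env A Γ) :
    Submodule (A.carrier VSort.K) (Var Γ VSort.M → A.carrier VSort.K) :=
  LinearMap.ker (Fintype.linearCombination (A.carrier VSort.K) (ρ VSort.M))

theorem mem_relations {ρ : Env A Γ} {z : Var Γ VSort.M → A.carrier VSort.K} :
    z ∈ relations ρ ↔ ∑ y, z y • ρ VSort.M y = 0 := LinearMap.mem_ker

/-- `X` is a tuple of coordinates of the assignment `ρ`. -/
structure Rep (X : Idx Γ → A.carrier VSort.K) (ρ : Env A Γ) : Prop where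
  k : ∀ x, X (.inl x) = ρ VSort.K x
  g : ∀ p : (Σ i : ℕ+, Var Γ (VSort.G i)), gPart X p = GrInterp.sub (ρ (VSort.G p.1) p.2)
  m : mPart X = relations ρ

theorem exists_rep (ρ : Env A Γ) : ∃ X : Idx Γ → A.carrier VSort.K, Rep X ρ := by
  choose G hG using fun p : (Σ i : ℕ+, Var Γ (VSort.G i)) =>
    exists_matSpan_eq (GrInterp.sub (ρ (VSort.G p.1) p.2))
  obtain ⟨M, hM⟩ := exists_matSpan_eq (relations ρ)
  exact ⟨Sum.elim (ρ VSort.K) (Sum.elim (fun q => G q.1 q.2) M), fun _ => rfl, hG, hM⟩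

theorem exists_sub_eq {i : ℕ+} (U : Submodule (A.carrier VSort.K) (Fin i → A.carrier VSort.K)) :
    ∃ g : A.carrier (VSort.G i), GrInterp.sub g = U := by
  obtain ⟨X, hX⟩ := exists_matSpan_eq U
  exact ⟨_, (GrInterp.sub_pi i X).trans hX⟩

theorem extZero_mem_relations {s : VSort} {ρ : Env A Γ} {a : A.carrier s}
    {z : Var Γ VSort.M → A.carrier VSort.K} :
    extZero z ∈ relations (Env.cons (L := sig) a ρ) ↔ z ∈ relations ρ := by
  rw [mem_relations, mem_relations, sum_extZero_smul]
  rfl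

/-- The quotient by the relations is the span of the values, of dimension at most `d`. Preimages of
`d` vectors spanning it serve as the correcting vectors `t`. -/
theorem codimLE_relations {d : ℕ∞} (hd : HasDim A d) (ρ : Env A Γ) : CodimLE (relations ρ) d := by
  cases d with
  | top => trivial
  | coe d =>
    obtain ⟨hfin, hrank⟩ := hd
    let L := Fintype.linearCombination (A.carrier VSort.K) (ρ VSort.M)
    have h : Module.finrank (A.carrier VSort.K) L.range ≤ Fintype.card (Fin d) := by
      rw [Fintype.card_fin, ← hrank]
      exact Submodule.finrank_le _
    obtain ⟨b, hb⟩ := exists_span_range_eq_top h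
    choose t ht using fun a => (b a).2
    refine ⟨fun ab => t ab.1 ab.2, fun z => ?_⟩
    -- With the sign, adding the combination of the `t a` to `z` lands in the kernel.
    have hz : (⟨L (-z), ⟨-z, rfl⟩⟩ : L.range) ∈ Submodule.span (A.carrier VSort.K) (Set.range b) := by
      rw [hb]; trivial
    obtain ⟨c, hc⟩ := (Submodule.mem_span_range_iff_exists_fun _).mp hz
    refine ⟨c, ?_⟩
    have hz' : (fun y => z y + ∑ a, c a * t a y) = z + ∑ a, c a • t a := by
      ext y
      simp
    have hc' : ∑ a, c a • (b a : A.carrier VSort.M) = L (-z) := by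
      simpa using congrArg Subtype.val hc
    rw [relations, LinearMap.mem_ker, hz']
    change L _ = 0
    rw [map_add, map_sum]
    simp only [map_smul, ht]
    rw [hc', map_neg, add_neg_cancel]

/-- If every element of `U` vanishes at the new variable, then `U` consists of the old relations,
and the quotient by `U` is the product of `K` with the old span. Were that span all of a
`d`-dimensional `M`, the codimension would be `d + 1`. -/
theorem span_ne_top {d : ℕ∞} (hd : HasDim A d) {ρ : Env A Γ}
    {U : Submodule (A.carrier VSort.K) (Var (VSort.M :: Γ) VSort.M → A.carrier VSort.K)}
    (hU : ∀ z, z ∈ relations ρ ↔ extZero z ∈ U) (hU' : ∀ z ∈ U, z .zero = 0) (hc : CodimLE U d) :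
    Submodule.span (A.carrier VSort.K) (Set.range (ρ VSort.M)) ≠ ⊤ := by
  intro htop
  cases d with
  | top => exact hd ⟨htop ▸ Submodule.fg_span (Set.finite_range _)⟩
  | coe d =>
    obtain ⟨hfin, hrank⟩ := hd
    obtain ⟨t, ht⟩ := hc
    let L : (Var (VSort.M :: Γ) VSort.M → A.carrier VSort.K) →ₗ[A.carrier VSort.K]
        A.carrier VSort.K × A.carrier VSort.M :=
      (LinearMap.proj Var.zero).prod
        (Fintype.linearCombination (A.carrier VSort.K) (ρ VSort.M) ∘ₗ
          LinearMap.funLeft _ _ Var.succ)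
    have hL : ∀ z, L z = (z .zero, ∑ x, z (.succ x) • ρ VSort.M x) := fun z => rfl
    have hker : ∀ z ∈ U, L z = 0 := by
      intro z hz
      have h0 := hU' z hz
      have : z = extZero fun x => z (.succ x) := by
        ext y
        cases y with
        | zero => exact h0
        | succ x => rfl
      rw [this, ← hU, mem_relations] at hz
      rw [hL, h0, hz]
      rfl
    -- As `L` is onto and kills `U`, the images of the `d` correcting vectors span `K × M`, which
    -- has dimension `d + 1`.
    have hspan : Submodule.span (A.carrier VSort.K) (Set.range fun a => L fun b => t (a, b)) = ⊤ := by
      rw [eq_top_iff]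
      rintro ⟨k, v⟩ -
      have hv : v ∈ Submodule.span (A.carrier VSort.K) (Set.range (ρ VSort.M)) := by
        rw [htop]; trivial
      obtain ⟨z, hz⟩ := (Submodule.mem_span_range_iff_exists_fun _).mp hv
      let z' : Var (VSort.M :: Γ) VSort.M → A.carrier VSort.K := fun y => match y with
        | .zero => k
        | .succ x => z x
      have hz' : L z' = (k, v) := by rw [hL, ← hz]; rfl
      obtain ⟨c, hc⟩ := ht z'
      have h := hker _ hc
      have hs : (fun b => z' b + ∑ a, c a * t (a, b)) = z' + ∑ a, c a • fun b => t (a, b) := by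
        ext y
        simp
      rw [hs, map_add, map_sum, hz'] at h
      simp only [map_smul] at h
      rw [eq_neg_of_add_eq_zero_left h]
      exact Submodule.neg_mem _ (Submodule.sum_mem _ fun a _ => Submodule.smul_mem _ _
        (Submodule.subset_span ⟨a, rfl⟩))
    have := finrank_range_le_card (R := A.carrier VSort.K) fun a => L fun b => t (a, b)
    rw [Set.finrank, hspan, finrank_top, Module.finrank_prod, hrank, Module.finrank_self,
      Fintype.card_fin] at this
    omega

/-- Either no element of `U` involves the new variable, and any vector outside the old span works,
or some `u` in `U` does, and solving the relation `u` for the new variable determines the vector. -/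
theorem exists_vector {d : ℕ∞} (hd : HasDim A d) {ρ : Env A Γ}
    {U : Submodule (A.carrier VSort.K) (Var (VSort.M :: Γ) VSort.M → A.carrier VSort.K)}
    (hU : ∀ z, z ∈ relations ρ ↔ extZero z ∈ U) (hc : CodimLE U d) :
    ∃ v : A.carrier VSort.M, U = relations (Env.cons (L := sig) v ρ) := by
  have hmem : ∀ (v : A.carrier VSort.M) z, z ∈ relations (Env.cons (L := sig) v ρ) ↔
      z .zero • v + ∑ x, z (.succ x) • ρ VSort.M x = 0 := by
    intro v z
    rw [mem_relations, sum_var_cons_self]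
    rfl
  by_cases h : ∀ z ∈ U, z .zero = 0
  · have hne := span_ne_top hd hU h hc
    obtain ⟨v, -, hv⟩ := SetLike.exists_of_lt hne.lt_top
    refine ⟨v, ?_⟩
    ext z
    rw [hmem]
    by_cases hz : z .zero = 0
    · have : z = extZero fun x => z (.succ x) := by
        ext y
        cases y with
        | zero => exact hz
        | succ x => rfl
      rw [hz, zero_smul, zero_add, ← mem_relations, hU, ← this]
    · refine iff_of_false (fun h' => hz (h z h')) fun h' => hv ?_
      -- A relation with nonzero new coordinate would put `v` into the old span.
      have : v = ∑ x, (-((z .zero)⁻¹ * z (.succ x))) • ρ VSort.M x := by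
        simp only [neg_smul, mul_smul, Finset.sum_neg_distrib, ← Finset.smul_sum]
        rw [← smul_neg, ← eq_neg_of_add_eq_zero_left h', inv_smul_smul₀ hz]
      rw [this]
      exact Submodule.sum_mem _ fun x _ => Submodule.smul_mem _ _ (Submodule.subset_span ⟨x, rfl⟩)
  · push Not at h
    obtain ⟨u, hu, hu0⟩ := h
    refine ⟨-∑ x, ((u .zero)⁻¹ * u (.succ x)) • ρ VSort.M x, ?_⟩
    ext z
    -- Subtracting this multiple of `u` kills the new coordinate and reduces membership to the old
    -- relations.
    have hz : z ∈ U ↔ z - (z .zero * (u .zero)⁻¹) • u ∈ U :=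
      (Submodule.sub_mem_iff_left U (U.smul_mem _ hu)).symm
    have : z - (z .zero * (u .zero)⁻¹) • u =
        extZero fun x => z (.succ x) - z .zero * ((u .zero)⁻¹ * u (.succ x)) := by
      ext y
      cases y with
      | zero => simp [extZero, hu0]
      | succ x => simp [extZero, mul_assoc]
    rw [hz, this, ← hU, mem_relations, hmem]
    simp only [sub_smul, Finset.sum_sub_distrib, mul_smul, ← Finset.smul_sum, smul_neg]
    rw [sub_eq_neg_add]

/-- For a variable of sort `K` or `G i` the new value is read off from `Z`, and the relations cannot
change. For sort `M` the value comes from `exists_vector`. -/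
theorem compat_iff {d : ℕ∞} (hd : HasDim A d) {s : VSort} {ρ : Env A Γ}
    {X : Idx Γ → A.carrier VSort.K} (hX : Rep X ρ) {Z : Idx (s :: Γ) → A.carrier VSort.K} :
    Compat d X Z ↔ ∃ a : A.carrier s, Rep Z (Env.cons (L := sig) a ρ) := by
  constructor
  · rintro ⟨hk, hg, hm, hc⟩
    simp only [hX.k] at hk
    simp only [hX.g] at hg
    simp only [hX.m] at hm
    have hm' : ∀ a : A.carrier s, s ≠ VSort.M → mPart Z = relations (Env.cons (L := sig) a ρ) := by
      intro a hs
      ext z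
      have : z = extZero fun x => z (.succ x) := by
        ext y
        cases y with
        | zero => exact absurd rfl hs
        | succ x => rfl
      rw [this, ← hm, extZero_mem_relations]
    cases s with
    | K =>
      refine ⟨Z (.inl .zero), fun x => ?_, fun p => ?_, hm' _ (by simp)⟩
      · cases x with
        | zero => rfl
        | succ x => exact hk x
      · obtain ⟨i, x⟩ := p
        cases x with
        | succ x => exact hg ⟨i, x⟩
    | G i =>
      obtain ⟨g, hg'⟩ := exists_sub_eq (gPart Z ⟨i, .zero⟩)
      refine ⟨g, fun x => ?_, fun p => ?_, hm' _ (by simp)⟩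
      · cases x with
        | succ x => exact hk x
      · obtain ⟨i, x⟩ := p
        cases x with
        | zero => exact hg'.symm
        | succ x => exact hg ⟨i, x⟩
    | M =>
      obtain ⟨v, hv⟩ := exists_vector hd hm hc
      refine ⟨v, fun x => ?_, fun p => ?_, hv⟩
      · cases x with
        | succ x => exact hk x
      · obtain ⟨i, x⟩ := p
        cases x with
        | succ x => exact hg ⟨i, x⟩
  · rintro ⟨a, hZ⟩
    refine ⟨fun x => ?_, fun p => ?_, fun z => ?_, ?_⟩
    · rw [hZ.k, hX.k]; rfl
    · exact (hZ.g _).trans (hX.g p).symm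
    · rw [hX.m, hZ.m, extZero_mem_relations]
    · rw [hZ.m]
      exact codimLE_relations hd _

end Rep

/-! ### Definability of the coordinate conditions -/

theorem QFDef.comp_elim {V W V' : Type} {S : PredFamily.{u} (V ⊕ W)} (hS : QFDef S)
    {f : V → FnFamily.{u} V'} (hf : ∀ v, IsPoly (f v)) {g : W → FnFamily.{u} V'}
    (hg : ∀ w, IsPoly (g w)) :
    QFDef fun K _ _ x => S K (Sum.elim (fun v => f v K x) fun w => g w K x) :=
  (hS.comp (g := Sum.elim f g) (by rintro (v | w) <;> simp [hf, hg])).congr fun K _ _ x =>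
    iff_of_eq (congrArg (S K) (funext fun v => by rcases v with v | w <;> rfl))

theorem QFDef.subst_elim {V W V' : Type} (θ : FieldQF (V ⊕ W))
    {f : V → FnFamily.{u} V'} (hf : ∀ v, IsPoly (f v)) {g : W → FnFamily.{u} V'}
    (hg : ∀ w, IsPoly (g w)) :
    QFDef fun K _ _ x => θ.Sat (Sum.elim (fun v => f v K x) fun w => g w K x) :=
  QFDef.comp_elim (S := fun _ _ _ x => θ.Sat x) ⟨θ, fun _ _ _ _ => Iff.rfl⟩ hf hg

theorem IsPoly.reindex {V V' : Type} {f : FnFamily.{u} V} (hf : IsPoly f) (e : V → V') :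
    IsPoly fun K _ _ x => f K (x ∘ e) :=
  hf.comp (g := fun v K _ _ x => x (e v)) fun v => .var (e v)

theorem QFDef.reindex {V V' : Type} {S : PredFamily.{u} V} (hS : QFDef S) (e : V → V') :
    QFDef fun K _ _ x => S K (x ∘ e) :=
  hS.comp (g := fun v K _ _ x => x (e v)) fun v => .var (e v)

theorem QFDef.mem_matSpan {V n : Type} [Finite n] {X : n × n → FnFamily.{u} V}
    (hX : ∀ ab, IsPoly (X ab)) {z : n → FnFamily.{u} V} (hz : ∀ b, IsPoly (z b)) :
    QFDef fun K _ _ x => (fun b => z b K x) ∈ matSpan fun ab => X ab K x :=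
  QFDef.mem_rowSpan (X := fun a b => X (a, b)) (fun _ _ => hX _) hz

theorem QFDef.var_mem_matSpan {V n : Type} [Finite n] (X : n × n → V) (z : n → V) :
    QFDef.{u} fun _ _ _ x => (fun b => x (z b)) ∈ matSpan fun ab => x (X ab) :=
  .mem_matSpan (X := fun ab _ _ _ x => x (X ab)) (fun _ => .var _)
    (z := fun b _ _ _ x => x (z b)) fun _ => .var _

/-- Equality of subspaces is tested on all vectors, and the quantifier over vectors is eliminated.
-/
theorem QFDef.matSpan_eq {V n : Type} [Finite n] (X Y : n × n → V) :
    QFDef.{u} fun _ _ _ x => (matSpan fun ab => x (X ab)) = matSpan fun ab => x (Y ab) := by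
  simp only [SetLike.ext_iff]
  refine QFDef.forall (W := n) ?_
  refine .iff ?_ ?_
  · exact .var_mem_matSpan _ _
  · exact .var_mem_matSpan _ _

theorem QFDef.codimLE {V C : Type} [Finite C] (X : C × C → V) (d : ℕ∞) :
    QFDef.{u} fun _ _ _ x => CodimLE (matSpan fun ab => x (X ab)) d := by
  cases d with
  | top => exact .true
  | coe d =>
    change QFDef.{u} fun K _ _ x => ∃ t : Fin d × C → K, ∀ z : C → K, ∃ c : Fin d → K,
      (fun b => z b + ∑ a, c a * t (a, b)) ∈ matSpan fun ab => x (X ab)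
    refine QFDef.exists ?_
    refine QFDef.forall ?_
    refine QFDef.exists ?_
    exact .mem_matSpan
      (X := fun ab K _ _ x => x (Sum.inl (Sum.inl (Sum.inl (X ab))))) (fun ab => .var _)
      (z := fun b K _ _ x => x (Sum.inl (Sum.inr b)) +
        ∑ a, x (Sum.inr a) * x (Sum.inl (Sum.inl (Sum.inr (a, b)))))
      fun b => .add (.var _) (.sum fun a => .mul (.var _) (.var _))

theorem QFDef.var_eq_var {V : Type} (v w : V) : QFDef.{u} fun _ _ _ x => x v = x w :=
  .eq (.var v) (.var w)

theorem QFDef.compat (d : ℕ∞) (Γ : List VSort) (s : VSort) :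
    QFDef.{u} (V := Idx Γ ⊕ Idx (s :: Γ)) fun _ _ _ x =>
      Compat d (x ∘ Sum.inl) (x ∘ Sum.inr) := by
  have h₁ : QFDef.{u} (V := Idx Γ ⊕ Idx (s :: Γ)) fun _ _ _ x =>
      ∀ v : Var Γ VSort.K, x (Sum.inr (Sum.inl v.succ)) = x (Sum.inl (Sum.inl v)) :=
    .forall_fintype fun v => .var_eq_var _ _
  have h₂ : QFDef.{u} (V := Idx Γ ⊕ Idx (s :: Γ)) fun _ _ _ x =>
      ∀ p : (Σ i : ℕ+, Var Γ (VSort.G i)),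
        (matSpan fun ab => x (Sum.inr (Sum.inr (Sum.inl ⟨⟨p.1, p.2.succ⟩, ab⟩)))) =
          matSpan fun ab => x (Sum.inl (Sum.inr (Sum.inl ⟨p, ab⟩))) :=
    .forall_fintype fun p => .matSpan_eq _ _
  have h₃ : QFDef.{u} (V := Idx Γ ⊕ Idx (s :: Γ)) fun K _ _ x =>
      ∀ z : Var Γ VSort.M → K, (z ∈ matSpan fun ab => x (Sum.inl (Sum.inr (Sum.inr ab)))) ↔
        extZero z ∈ matSpan fun ab => x (Sum.inr (Sum.inr (Sum.inr ab))) := by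
    refine QFDef.forall ?_
    refine .iff ?_ ?_
    · exact .var_mem_matSpan _ _
    · refine .mem_matSpan (X := fun ab K _ _ x => x (Sum.inl (Sum.inr (Sum.inr (Sum.inr ab)))))
        (fun ab => .var _)
        (z := fun y K _ _ x => extZero (fun v => x (Sum.inr v)) y) fun y => ?_
      cases y with
      | zero => exact .zero
      | succ y => exact .var (Sum.inr y)
  have h₄ : QFDef.{u} (V := Idx Γ ⊕ Idx (s :: Γ)) fun _ _ _ x =>
      CodimLE (matSpan fun ab => x (Sum.inr (Sum.inr (Sum.inr ab)))) d := .codimLE _ d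
  exact h₁.and (h₂.and (h₃.and h₄))

/-! ### Definability of terms and formulas -/

/-- The value of a term is given by polynomials, respectively definable predicates, in coordinates
of the assignment. -/
def TermDef {Γ : List VSort} : (s : VSort) → Term sig Γ s → Prop
  | .K, t => ∃ f : FnFamily.{u} (Idx Γ), IsPoly f ∧
      ∀ (A : Structure.{u} sig) [GrInterp A] (ρ : Env A Γ) (X : Idx Γ → A.carrier VSort.K),
        Rep X ρ → t.eval ρ = f (A.carrier VSort.K) X
  | .M, t => ∃ f : Var Γ VSort.M → FnFamily.{u} (Idx Γ), (∀ y, IsPoly (f y)) ∧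
      ∀ (A : Structure.{u} sig) [GrInterp A] (ρ : Env A Γ) (X : Idx Γ → A.carrier VSort.K),
        Rep X ρ → t.eval ρ = ∑ y, f y (A.carrier VSort.K) X • ρ VSort.M y
  | .G i, t => ∃ S : PredFamily.{u} (Idx Γ ⊕ Fin i), QFDef S ∧
      ∀ (A : Structure.{u} sig) [GrInterp A] (ρ : Env A Γ) (X : Idx Γ → A.carrier VSort.K),
        Rep X ρ → ∀ z : Fin i → A.carrier VSort.K,
          z ∈ GrInterp.sub (t.eval ρ) ↔ S (A.carrier VSort.K) (Sum.elim X z)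

theorem termDef {Γ : List VSort} {s : VSort} (t : Term sig Γ s) : TermDef.{u} s t := by
  refine Term.rec (L := sig) (motive := fun s t => TermDef.{u} s t) (fun {s} x => ?_)
    (fun {s} f args ih => ?_) t
  · clear t
    cases s with
    | K => exact ⟨fun _ _ _ y => y (Sum.inl x), .var _, fun A _ ρ X h => (h.k x).symm⟩
    | M =>
      classical
      refine ⟨fun y K _ _ _ => if y = x then 1 else 0, fun y => ?_, fun A _ ρ X h => ?_⟩
      · by_cases hy : y = x
        · simpa [hy] using IsPoly.one
        · simpa [hy] using IsPoly.zero
      · simp only [ite_smul, one_smul, zero_smul, Finset.sum_ite_eq', Finset.mem_univ, if_true]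
        rfl
    | G i =>
      refine ⟨fun _ _ _ w => (fun b => w (Sum.inr b)) ∈
          matSpan fun ab => w (Sum.inl (Sum.inr (Sum.inl ⟨⟨i, x⟩, ab⟩))),
        .var_mem_matSpan _ _, fun A _ ρ X h z => ?_⟩
      simp only [Sum.elim_inl, Sum.elim_inr]
      exact iff_of_eq (congrArg (z ∈ ·) (h.g ⟨i, x⟩).symm)
  · clear t
    cases f with
    | zeroK => exact ⟨_, .zero, fun A _ ρ X h => VSInterp.fn_zeroK _⟩
    | oneK => exact ⟨_, .one, fun A _ ρ X h => VSInterp.fn_oneK _⟩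
    | addK =>
      obtain ⟨f, hf, hf'⟩ := ih (0 : Fin 2)
      obtain ⟨g, hg, hg'⟩ := ih (1 : Fin 2)
      refine ⟨_, hf.add hg, fun A _ ρ X h => ?_⟩
      rw [← hf' A ρ X h, ← hg' A ρ X h]
      exact VSInterp.fn_addK _
    | mulK =>
      obtain ⟨f, hf, hf'⟩ := ih (0 : Fin 2)
      obtain ⟨g, hg, hg'⟩ := ih (1 : Fin 2)
      refine ⟨_, hf.mul hg, fun A _ ρ X h => ?_⟩
      rw [← hf' A ρ X h, ← hg' A ρ X h]
      exact VSInterp.fn_mulK _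
    | zeroM =>
      refine ⟨_, fun y => .zero, fun A _ ρ X h => ?_⟩
      simp only [zero_smul, Finset.sum_const_zero]
      exact VSInterp.fn_zeroM _
    | addM =>
      obtain ⟨f, hf, hf'⟩ := ih (0 : Fin 2)
      obtain ⟨g, hg, hg'⟩ := ih (1 : Fin 2)
      refine ⟨_, fun y => (hf y).add (hg y), fun A _ ρ X h => ?_⟩
      simp only [add_smul, Finset.sum_add_distrib]
      rw [← hf' A ρ X h, ← hg' A ρ X h]
      exact VSInterp.fn_addM _
    | smul =>
      obtain ⟨f, hf, hf'⟩ := ih (0 : Fin 2)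
      obtain ⟨g, hg, hg'⟩ := ih (1 : Fin 2)
      refine ⟨_, fun y => hf.mul (hg y), fun A _ ρ X h => ?_⟩
      simp only [mul_smul, ← Finset.smul_sum]
      rw [← hf' A ρ X h, ← hg' A ρ X h]
      exact VSInterp.fn_smul _
    | pi i =>
      choose f hf hf' using ih
      refine ⟨fun K _ _ w => (fun b => w (Sum.inr b)) ∈
          matSpan fun ab : Fin i × Fin i => f ab K fun v => w (Sum.inl v),
        .mem_matSpan (fun ab => (hf ab).reindex _) fun b => .var _, fun A _ ρ X h z => ?_⟩
      simp only [Sum.elim_inl, Sum.elim_inr]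
      have e : (fun ab : Fin i × Fin i => f ab _ X) = fun ab => (args ab).eval ρ :=
        funext fun ab => (hf' ab A ρ X h).symm
      rw [e]
      exact iff_of_eq (congrArg (z ∈ ·) (GrInterp.sub_pi i _))
    | D i =>
      choose f hf hf' using ih
      -- A combination of the arguments of `D` vanishes exactly when the resulting coefficient
      -- vector on the `M`-variables is a relation.
      refine ⟨fun K _ _ w =>
          (fun y => ∑ a : Fin i, w (Sum.inr a) * f a y K fun v => w (Sum.inl v)) ∈
            matSpan fun ab => w (Sum.inl (Sum.inr (Sum.inr ab))),
        .mem_matSpan (fun ab => .var _) fun y => .sum fun a => .mul (.var _) ((hf a y).reindex _),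
        fun A _ ρ X h z => (GrInterp.mem_sub_D i _ z).trans ?_⟩
      simp only [Sum.elim_inl, Sum.elim_inr]
      change _ ↔ _ ∈ mPart X
      rw [h.m, mem_relations]
      simp only [Finset.sum_smul, mul_smul]
      rw [Finset.sum_comm]
      simp only [← Finset.smul_sum]
      exact iff_of_eq (congrArg (· = 0) (Finset.sum_congr rfl fun a _ =>
        congrArg (z a • ·) (hf' a A ρ X h)))

/-- The formula is given by a definable predicate in coordinates of the assignment. -/
def FormulaDef (d : ℕ∞) {Γ : List VSort} (φ : Fm Γ) : Prop :=
  ∃ S : PredFamily.{u} (Idx Γ), QFDef S ∧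
    ∀ (A : Structure.{u} sig) [GrInterp A], HasDim A d → ∀ (ρ : Env A Γ)
      (X : Idx Γ → A.carrier VSort.K), Rep X ρ → (φ.Sat ρ ↔ S (A.carrier VSort.K) X)

theorem formulaDef_eq (d : ℕ∞) {Γ : List VSort} {s : VSort} (t t' : Term sig Γ s) :
    FormulaDef.{u} d (Formula.eq (L := sig) t t') := by
  have ht := termDef.{u} t
  have ht' := termDef.{u} t'
  cases s with
  | K =>
    obtain ⟨f, hf, hf'⟩ := ht
    obtain ⟨g, hg, hg'⟩ := ht'
    refine ⟨_, .eq hf hg, fun A _ _ ρ X h => ?_⟩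
    rw [← hf' A ρ X h, ← hg' A ρ X h]
    rfl
  | M =>
    obtain ⟨f, hf, hf'⟩ := ht
    obtain ⟨g, hg, hg'⟩ := ht'
    -- Two combinations of the `M`-variables agree exactly when their coefficients differ by a
    -- relation.
    refine ⟨fun K _ _ x => ∃ z : Var Γ VSort.M → K,
      (z ∈ matSpan fun ab => x (Sum.inr (Sum.inr ab))) ∧ ∀ y, f y K x = g y K x + z y, ?_,
      fun A _ _ ρ X h => ?_⟩
    · refine QFDef.exists ?_
      refine .and (.var_mem_matSpan _ _) (.forall_fintype fun y => ?_)
      exact .eq ((hf y).reindex _) (((hg y).reindex _).add (.var _))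
    change _ ↔ ∃ z, z ∈ mPart X ∧ _
    rw [Formula.sat_eq, hf' A ρ X h, hg' A ρ X h, h.m]
    constructor
    · intro e
      refine ⟨fun y => f y _ X - g y _ X, ?_, fun y => by ring⟩
      simp only [mem_relations, sub_smul, Finset.sum_sub_distrib]
      exact sub_eq_zero.mpr e
    · rintro ⟨z, hz, e⟩
      rw [mem_relations] at hz
      simp only [e, add_smul, Finset.sum_add_distrib, hz, add_zero]
  | G i =>
    obtain ⟨S, hS, hS'⟩ := ht
    obtain ⟨T, hT, hT'⟩ := ht'
    refine ⟨fun K _ _ x => ∀ z : Fin i → K, S K (Sum.elim x z) ↔ T K (Sum.elim x z), ?_,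
      fun A _ _ ρ X h => ?_⟩
    · refine QFDef.forall ?_
      exact .iff (hS.comp_elim (fun v => .var _) fun v => .var _)
        (hT.comp_elim (fun v => .var _) fun v => .var _)
    simp only [← hS' A ρ X h, ← hT' A ρ X h]
    rw [← SetLike.ext_iff, (GrInterp.sub_injective i).eq_iff]
    rfl

/-- The argument subspaces are known only through membership of vectors, so representing matrices
are quantified over and pinned down by their row spans. -/
theorem formulaDef_rel (d : ℕ∞) {Γ : List VSort} (R : PartQF)
    (args : (i : Fin R.m ⊕ Fin R.l) → Term sig Γ (sig.relDom R i)) :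
    FormulaDef.{u} d (Formula.rel (L := sig) R args) := by
  choose S hS hS' using fun j => termDef.{u} (args (.inl j))
  choose f hf hf' using fun a => termDef.{u} (args (.inr a))
  refine ⟨fun K _ _ x => ∃ Y : (Σ j : Fin R.m, Fin (R.k j) × Fin (R.k j)) → K,
    R.φ.Sat (Sum.elim Y fun a => f a K x) ∧ ∀ j, ∀ z : Fin (R.k j) → K,
      (z ∈ matSpan fun ab => Y ⟨j, ab⟩) ↔ S j K (Sum.elim x z), ?_, fun A _ _ ρ X h => ?_⟩
  · refine QFDef.exists ?_
    refine .and (.subst_elim _ (fun v => .var _) fun a => (hf a).reindex _)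
      (.forall_fintype fun j => ?_)
    refine QFDef.forall ?_
    exact .iff (.var_mem_matSpan _ _) ((hS j).comp_elim (fun v => .var _) fun v => .var _)
  refine (GrInterp.rel_iff R _).trans ?_
  simp only [← hS' _ A ρ X h, ← hf' _ A ρ X h, ← SetLike.ext_iff]
  rfl

theorem formulaDef (d : ℕ∞) {Γ : List VSort} (φ : Fm Γ) : FormulaDef.{u} d φ := by
  refine Formula.rec (L := sig) (motive := fun Γ φ => FormulaDef.{u} d φ) ?_ ?_ ?_ ?_ ?_ φ
  · intro Γ
    exact ⟨_, .falsum, fun A _ _ ρ X h => Iff.rfl⟩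
  · intro Γ s t t'
    exact formulaDef_eq d t t'
  · intro Γ R args
    exact formulaDef_rel d R args
  · intro Γ φ ψ hφ hψ
    obtain ⟨S, hS, hS'⟩ := hφ
    obtain ⟨T, hT, hT'⟩ := hψ
    exact ⟨_, hS.imp hT, fun A _ hd ρ X h => imp_congr (hS' A hd ρ X h) (hT' A hd ρ X h)⟩
  · intro Γ s φ hφ
    obtain ⟨S, hS, hS'⟩ := hφ
    -- By `compat_iff`, compatible tuples are exactly the coordinates of one-element extensions, so
    -- the quantifier moves to the field.
    refine ⟨fun K _ _ x => ∀ Z, Compat d x Z → S K Z, ?_, fun A _ hd ρ X h => ?_⟩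
    · refine QFDef.forall ?_
      exact (QFDef.compat d _ s).imp (hS.reindex _)
    simp only [Formula.sat_all, compat_iff hd h]
    constructor
    · rintro hall Z ⟨a, hZ⟩
      exact (hS' A hd _ Z hZ).mp (hall a)
    · intro hall a
      obtain ⟨Z, hZ⟩ := exists_rep (Env.cons (L := sig) a ρ)
      exact (hS' A hd _ Z hZ).mpr (hall Z ⟨a, hZ⟩)

/-! ### Quantifier elimination -/

section Grassmannian

variable {i : ℕ+} (e : Fin i ≃ Option (Var Γ VSort.M))

/-- A variable of the sort `M`, or zero, as a term. -/
def optionTerm : Option (Var Γ VSort.M) → MTerm Γ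
  | none => zeroM
  | some y => .var y

/-- The sizes of the subspaces attached to the variables of the sorts `G i`, and to the tuple of all
variables of the sort `M`. -/
def argSize (i : ℕ+) : Option (Σ j : ℕ+, Var Γ (VSort.G j)) → ℕ+
  | none => i
  | some p => p.1

/-- The variables of the sorts `G i`, and the space of linear relations between the variables of the
sort `M` and zero, as terms. -/
def argTerm : (o : Option (Σ j : ℕ+, Var Γ (VSort.G j))) → GTerm Γ (argSize i o)
  | none => DG i fun a => optionTerm (e a)
  | some p => .var p.2

/-- The value of `argTerm e o` is `U` in terms of the coordinates `Z`. -/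
def ArgRel {K : Type u} [Field K] (Z : Idx Γ → K) :
    (o : Option (Σ j : ℕ+, Var Γ (VSort.G j))) → Submodule K (Fin (argSize i o) → K) → Prop
  | none, U => ∀ z : Var Γ VSort.M → K, z ∈ mPart Z ↔ (fun a => (e a).elim 0 z) ∈ U
  | some p, U => gPart Z p = U

/-- The added zero vector contributes nothing to a linear combination, so the relations among the
`M`-variables are the vectors of the subspace named by `D`, restricted to coordinate zero there. -/
theorem argRel_iff {A : Structure.{u} sig} [GrInterp A] {ρ : Env A Γ}
    {Z : Idx Γ → A.carrier VSort.K} :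
    Rep Z ρ ↔ (∀ x, Z (.inl x) = ρ VSort.K x) ∧
      ∀ o, ArgRel e Z o (GrInterp.sub ((argTerm e o).eval ρ)) := by
  have hnone : ∀ z : Var Γ VSort.M → A.carrier VSort.K,
      (fun a => (e a).elim 0 z) ∈ GrInterp.sub ((argTerm e none).eval ρ) ↔ z ∈ relations ρ := by
    intro z
    refine (GrInterp.mem_sub_D i _ _).trans ?_
    rw [mem_relations]
    refine iff_of_eq (congrArg (· = 0) ((e.sum_comp fun o => o.elim 0 z •
      (optionTerm o).eval ρ).trans ?_))
    rw [Fintype.sum_option, Option.elim_none, zero_smul, zero_add]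
    rfl
  constructor
  · intro h
    refine ⟨h.k, fun o => ?_⟩
    rcases o with _ | p
    · intro z
      rw [hnone, h.m]
    · exact h.g p
  · rintro ⟨hk, h⟩
    refine ⟨hk, fun p => h (some p), ?_⟩
    ext z
    rw [← hnone]
    exact h none z

theorem QFDef.argRel {V : Type} (Z : Idx Γ → V) (o : Option (Σ j : ℕ+, Var Γ (VSort.G j)))
    (Y : Fin (argSize i o) × Fin (argSize i o) → V) :
    QFDef.{u} fun _ _ _ x =>
      ArgRel e (fun v => x (Z v)) o (matSpan fun ab => x (Y ab)) := by
  rcases o with _ | p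
  · have h : QFDef.{u} fun K _ _ x => ∀ z : Var Γ VSort.M → K,
        (z ∈ matSpan fun ab => x (Z (Sum.inr (Sum.inr ab)))) ↔
          (fun a => (e a).elim 0 z) ∈ matSpan fun ab => x (Y ab) := by
      refine QFDef.forall ?_
      refine .iff (.var_mem_matSpan _ _) ?_
      refine .mem_matSpan (n := Fin i) (X := fun ab K _ _ x => x (Sum.inl (Y ab))) (fun ab => .var _)
        (z := fun a K _ _ x => (e a).elim 0 fun w => x (Sum.inr w)) fun a => ?_
      rcases e a with _ | y
      · exact .zero
      · exact .var _
    exact h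
  · exact .matSpan_eq (n := Fin p.1) (fun ab => Z (Sum.inr (Sum.inl ⟨p, ab⟩))) Y

end Grassmannian

/-- The atomic formula chosen says that matrices for the named subspaces exist from which
coordinates satisfying `S` can be recovered; the inner existential quantifier over coordinates is
eliminated to obtain a legitimate index for the predicate. -/
theorem exists_qf_of_formulaDef {d : ℕ∞} {Γ : List VSort} {φ : Fm Γ} (h : FormulaDef.{u} d φ) :
    ∃ ψ : Fm Γ, ψ.IsQF ∧ ∀ (A : Structure.{u} sig) [GrInterp A], HasDim A d → ∀ ρ : Env A Γ,
      φ.Sat ρ ↔ ψ.Sat ρ := by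
  obtain ⟨S, hS, hφ⟩ := h
  -- Adjoining the zero vector keeps the size positive when there is no variable of sort `M`.
  let i : ℕ+ := ⟨Fintype.card (Option (Var Γ VSort.M)), Fintype.card_pos⟩
  let e : Fin i ≃ Option (Var Γ VSort.M) := (Fintype.equivFin _).symm
  obtain ⟨m, ⟨eG⟩⟩ := Finite.exists_equiv_fin (Option (Σ j : ℕ+, Var Γ (VSort.G j)))
  obtain ⟨l, ⟨eK⟩⟩ := Finite.exists_equiv_fin (Var Γ VSort.K)
  have hT : QFDef.{u}
      (V := (Σ j : Fin m, Fin (argSize i (eG.symm j)) × Fin (argSize i (eG.symm j))) ⊕ Fin l)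
      fun K _ _ y => ∃ Z : Idx Γ → K, (∀ a, Z (Sum.inl (eK.symm a)) = y (Sum.inr a)) ∧
        (∀ j, ArgRel e Z (eG.symm j) (matSpan fun ab => y (Sum.inl ⟨j, ab⟩))) ∧ S K Z := by
    refine QFDef.exists ?_
    refine .and (.forall_fintype fun a => .var_eq_var _ _) (.and (.forall_fintype fun j => ?_) ?_)
    · exact .argRel e _ _ _
    · exact hS.reindex _
  obtain ⟨θ, hθ⟩ := hT
  let R : PartQF := ⟨m, fun j => argSize i (eG.symm j), l, θ⟩
  refine ⟨predP R (fun j => argTerm e (eG.symm j)) fun a => .var (eK.symm a), trivial,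
    fun A _ hd ρ => ?_⟩
  rw [sat_predP, GrInterp.rel_iff]
  constructor
  · intro hsat
    obtain ⟨Z, hZ⟩ := exists_rep ρ
    choose Y hY using fun j : Fin m =>
      exists_matSpan_eq (GrInterp.sub ((argTerm e (eG.symm j)).eval ρ))
    refine ⟨fun c => Y c.1 c.2, (hθ _ _).mpr ⟨Z, fun a => hZ.k _, fun j => ?_,
      (hφ A hd ρ Z hZ).mp hsat⟩, hY⟩
    simp only [Sum.elim_inl]
    rw [hY]
    exact ((argRel_iff e).mp hZ).2 _
  · rintro ⟨Y, hsat, hY⟩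
    obtain ⟨Z, hk, hg, hSZ⟩ := (hθ _ _).mp hsat
    -- The recovered `Z` is not chosen in advance, but any tuple with the right subspaces represents
    -- `ρ`.
    refine (hφ A hd ρ Z ((argRel_iff e).mpr ⟨fun x => ?_, fun o => ?_⟩)).mpr hSZ
    · have := hk (eK x)
      simp only [Equiv.symm_apply_apply, Sum.elim_inr] at this
      exact this
    · obtain ⟨j, rfl⟩ := eG.symm.surjective o
      have := hg j
      simp only [Sum.elim_inl] at this
      rw [hY j] at this
      exact this

theorem hasQE_theoryACF (d : ℕ∞) : HasQE.{u} (theoryACF d) := by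
  intro Γ φ
  obtain ⟨ψ, hψ, h⟩ := exists_qf_of_formulaDef (formulaDef.{u} d φ)
  refine ⟨ψ, hψ, fun A hA ρ => ?_⟩
  obtain ⟨_, hd⟩ := exists_grInterp_of_isModel hA
  exact Formula.sat_iff.mpr (h A hd ρ)

/-! ### Completeness -/

/-- Closed terms are built from 0 and 1 by sums and products, so they are numerals independent of
the field. -/
theorem FieldTerm.exists_eval_eq_natCast {V : Type} [IsEmpty V] (t : FieldTerm V) :
    ∃ n : ℕ, ∀ (K : Type u) [Field K] (x : V → K), t.eval x = n := by
  induction t with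
  | var v => exact isEmptyElim v
  | zero => exact ⟨0, fun K _ x => Nat.cast_zero.symm⟩
  | one => exact ⟨1, fun K _ x => Nat.cast_one.symm⟩
  | add a b ha hb =>
    obtain ⟨m, hm⟩ := ha
    obtain ⟨n, hn⟩ := hb
    exact ⟨m + n, fun K _ x => by rw [FieldTerm.eval, hm, hn, Nat.cast_add]⟩
  | mul a b ha hb =>
    obtain ⟨m, hm⟩ := ha
    obtain ⟨n, hn⟩ := hb
    exact ⟨m * n, fun K _ x => by rw [FieldTerm.eval, hm, hn, Nat.cast_mul]⟩

/-- The truth of a quantifier-free sentence in a field depends on the characteristic only. -/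
theorem FieldQF.exists_sat_iff {V : Type} [IsEmpty V] (p : ℕ) (θ : FieldQF V) :
    ∃ P : Prop, ∀ (K : Type u) [Field K] [CharP K p] (x : V → K), θ.Sat x ↔ P := by
  induction θ with
  | falsum => exact ⟨False, fun K _ _ x => Iff.rfl⟩
  | eq a b =>
    obtain ⟨m, hm⟩ := a.exists_eval_eq_natCast
    obtain ⟨n, hn⟩ := b.exists_eval_eq_natCast
    exact ⟨m ≡ n [MOD p], fun K _ _ x => by
      rw [FieldQF.Sat, hm, hn, CharP.natCast_eq_natCast K p]⟩
  | imp φ ψ hφ hψ =>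
    obtain ⟨P, hP⟩ := hφ
    obtain ⟨Q, hQ⟩ := hψ
    exact ⟨P → Q, fun K _ _ x => imp_congr (hP K x) (hQ K x)⟩

theorem isComplete_theoryACF (d : ℕ∞) {p : ℕ} (hp : p = 0 ∨ p.Prime) :
    IsComplete.{u} (theoryACF d ∪ charAxioms p) := by
  refine ⟨exists_model d hp, fun σ => ?_⟩
  obtain ⟨S, ⟨θ, hθ⟩, hσ⟩ := formulaDef.{u} d σ
  -- The empty context has no coordinates, so `θ` is variable-free and only the characteristic
  -- matters.
  have hempty : IsEmpty (Idx []) := by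
    refine ⟨?_⟩
    rintro (x | ⟨⟨i, x⟩, _⟩ | ⟨x, _⟩) <;> cases x
  obtain ⟨P, hP⟩ := θ.exists_sat_iff.{u} p
  have key : ∀ A : Structure.{u} sig, IsModel A (theoryACF d ∪ charAxioms p) → ∀ ρ : Env A [],
      σ.Sat ρ ↔ P := by
    intro A hA ρ
    obtain ⟨hA, hchar⟩ := IsModel.union_iff.mp hA
    obtain ⟨_, hd⟩ := exists_grInterp_of_isModel hA
    have := (isModel_charAxioms_iff hp).mp hchar
    obtain ⟨X, hX⟩ := exists_rep ρ
    exact (hσ A hd ρ X hX).trans ((hθ _ X).symm.trans (hP _ X))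
  by_cases h : P
  · exact .inl fun A hA ρ => (key A hA ρ).mpr h
  · exact .inr fun A hA ρ => Formula.sat_not.mpr fun h' => h ((key A hA ρ).mp h')

end PureVS

/-- The theory of `d`-dimensional vector spaces over algebraically closed fields, with the
Grassmannian sorts, eliminates quantifiers, and it becomes complete once the characteristic is
fixed. -/
theorem mainTheorem3 :
    (∀ d : ℕ∞, ManySorted.HasQE.{u} (PureVS.theoryACF d)) ∧
      ∀ (d : ℕ∞) (p : ℕ), p = 0 ∨ p.Prime →
        ManySorted.IsComplete.{u} (PureVS.theoryACF d ∪ PureVS.charAxioms p) :=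
  ⟨PureVS.hasQE_theoryACF, fun d _ hp => PureVS.isComplete_theoryACF d hp⟩
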